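/- Let $\log$ be the natural logarithm. For a sample $x=(x_1,\dots,x_m)$ of letters and a finite alphabet $A$, let $N_i$ be the number of occurrences of the letter $i$ in $x$, and let the variable add-constant (Braess--Sauer) estimator $\hat\pi_{\mathrm{opt}}(x)$ on $A$ be the probability distribution on $A$ with $$\hat\pi_{\mathrm{opt}}(x)(i)=\frac{N_i+\beta_{N_i}}{\sum_{j\in A}(N_j+\beta_{N_j})},\qquad \beta_0=\tfrac12,\quad \beta_1=1,\quad \beta_r=\tfrac34\ (r\ge 2).$$ **Theorem.** There is a sequence $\varepsilon(n)\to 0$ ($n\to\infty$) such that for all integers $n,n_0\ge 1$ and $d,d_0\ge 1$ and all real $\Delta\ge 0$ there is an $\alpha\in[0,1]$ with the following property. Let $\pi$ be a probability distribution on an alphabet $A$ of size $d$ and $\pi^{(0)}$ a probability distribution on an alphabet $A_0$ of size $d_0$ (both alphabets being subsets of a common finite set, and distributions being extended by $0$), with $d_{\mathsf{KL}}(\pi\|\pi^{(0)})\le\Delta$. Let $X^n=(X_1,\dots,X_n)$ be i.i.d. samples from $\pi$ and $Y^{n_0}=(Y_1,\dots,Y_{n_0})$ i.i.d. samples from $\pi^{(0)}$,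 let $\hat\pi_{\mathrm{opt}}(X^n)$ be the above estimator on $A$ and $\hat\pi^{(0)}_{\mathrm{opt}}(Y^{n_0})$ the above estimator on $A_0$. Then the plug-in interpolation $$\hat\pi=\alpha\,\hat\pi_{\mathrm{opt}}(X^n)+(1-\alpha)\,\hat\pi^{(0)}_{\mathrm{opt}}(Y^{n_0})$$ has finite expected KL risk, and $$\mathbb E\big[d_{\mathsf{KL}}(\pi\|\hat\pi)\big]\le\min\left(\frac{d-1}{2n}+\varepsilon(n)\,\frac dn,\ \ \Delta+\log\Big(1+\frac{d_0}{n_0}\Big)+\log 2\right).$$ In particular $\alpha$ depends only on $n,n_0,d,d_0,\Delta$, and the term $\varepsilon(n)\,d/n$ is $o(d/n)$ as $n\to\infty$, uniformly in $d$ and in all other data. -/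

import Mathlib

open MeasureTheory ProbabilityTheory Filter Topology InformationTheory
open scoped ENNReal NNReal

namespace AddConstEstimation

/-- `N_i`: the number of occurrences of the letter `i` in the sample `x`. -/
def letterCount {V : Type*} [DecidableEq V] {n : ℕ} (x : Fin n → V) (i : V) : ℕ :=
  (Finset.univ.filter (fun j => x j = i)).card

/-- The variable add-constants of the Braess-Sauer estimator:
`1/2` for an unseen letter, `1` for a letter seen once, `3/4` for a letter seen more often. -/
noncomputable def addConst (r : ℕ) : ℝ :=
  if r = 0 then 1 / 2 else if r = 1 then 1 else 3 / 4

/-- The unnormalised weight `r + β_r` of a letter `i` seen `r` times in the sample `x`. -/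
noncomputable def optWeight {V : Type*} [DecidableEq V] {n : ℕ} (x : Fin n → V) (i : V) : ℝ :=
  (letterCount x i : ℝ) + addConst (letterCount x i)

/-- The variable add-constant estimator on the finite alphabet `A`, computed from the sample `x`:
the distribution on `A` whose mass at `i ∈ A` is proportional to `N_i + β_{N_i}`. -/
noncomputable def optEstimator {V : Type*} [DecidableEq V] [MeasurableSpace V]
    (A : Finset V) {n : ℕ} (x : Fin n → V) : Measure V :=
  ∑ i ∈ A, ENNReal.ofReal (optWeight x i / ∑ j ∈ A, optWeight x j) • Measure.dirac i

/-- The linear interpolation `α μ + (1 - α) ν` of two distributions. -/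
noncomputable def interpolate {V : Type*} [MeasurableSpace V]
    (α : ℝ) (μ ν : Measure V) : Measure V :=
  ENNReal.ofReal α • μ + ENNReal.ofReal (1 - α) • ν

/-- The expected KL loss `E[d_KL(π ‖ q)]` of a random distribution `q`. -/
noncomputable def klRisk {V Ω : Type*} [MeasurableSpace V] [MeasurableSpace Ω]
    (P : Measure Ω) (π : Measure V) (q : Ω → Measure V) : ℝ≥0∞ :=
  ∫⁻ ω, klDiv π (q ω) ∂P

/-- The plug-in interpolation `α π̂_opt(x) + (1 - α) π̂⁽⁰⁾_opt(y)`. -/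
noncomputable def plugin {V : Type*} [DecidableEq V] [MeasurableSpace V] (α : ℝ)
    (A A₀ : Finset V) {n n₀ : ℕ} (x : Fin n → V) (y : Fin n₀ → V) : Measure V :=
  interpolate α (optEstimator A x) (optEstimator A₀ y)

lemma addConst_pos (r : ℕ) : 0 < addConst r := by
  unfold addConst
  split_ifs <;> norm_num

lemma optWeight_pos {V : Type*} [DecidableEq V] {n : ℕ} (x : Fin n → V) (i : V) :
    0 < optWeight x i :=
  add_pos_of_nonneg_of_pos (Nat.cast_nonneg _) (addConst_pos _)

/-- On a nonempty alphabet the estimator is a probability distribution, for every sample. -/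
lemma isProbabilityMeasure_optEstimator {V : Type*} [DecidableEq V] [MeasurableSpace V]
    {A : Finset V} (hA : A.Nonempty) {n : ℕ} (x : Fin n → V) :
    IsProbabilityMeasure (optEstimator A x) := by
  have hS : 0 < ∑ j ∈ A, optWeight x j := Finset.sum_pos (fun j _ => optWeight_pos x j) hA
  refine ⟨?_⟩
  simp only [optEstimator, Measure.coe_finsetSum, Finset.sum_apply, Measure.smul_apply,
    measure_univ, smul_eq_mul, mul_one]
  rw [← ENNReal.ofReal_sum_of_nonneg
    (fun i _ => div_nonneg (optWeight_pos x i).le hS.le), ← Finset.sum_div, div_self hS.ne',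
    ENNReal.ofReal_one]

end AddConstEstimation

namespace AddConstEstimation

/-! The weight `α` is 0 or 1, chosen by which of the two bounds is smaller, so only one sample ever
enters and two separate risk bounds suffice.

The bound with `Δ` is `integral_klDiv_optEstimator_le_klDiv_add`. By concavity of the logarithm, a
letter of reference probability `ρ` contributes an expected log-ratio at most the log of the mean of
`ρ S / w`, with `S` the total weight and `w` the weight of the letter. Here `S ≤ n + d`, `1 / w ≤ 2
/ (N + 1)` and `(n + 1) ρ E[1 / (N + 1)] ≤ 1`.

The bound `(d - 1) / (2n) + o(d / n)` is that of Braess and Sauer. Linearising `log S` at `n` splits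
`n` times the risk into one `binomialLoss` per letter (`integral_klDiv_optEstimator_le`). It remains
to show that `binomialLoss n p ≤ (1 - p) / 2 + o(1)` uniformly in `p`, for then summation over the
letters gives `(d - 1) / 2 + o(d)`. For large `np` this is a Taylor expansion with binomial moments
(`binomialLoss_le_of_one_le`). For bounded `np`, compactness and the Poisson limit theorem reduce it
to `poissonLoss_le_half`.

The Poisson inequality rests on the second derivative of `poissonLoss`, which is `exp (-t) / t`
times the generating function of `curvSeq`. The coefficients of the latter have signs +, -, +, - and
are nonpositive from then on. Near 0 the inequality is an elementary estimate. On [0.55, 3.65] it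
follows from a quadratic Taylor bound at 2. Beyond 3.65 the loss is convex and then concave (either
stretch may be missing), and the concave part is controlled by its nonnegativity and its upper limit
1/2. -/

/-- Sequences growing at most exponentially. -/
def HasExpGrowth (f : ℕ → ℝ) : Prop := ∃ C D : ℝ, 0 ≤ C ∧ 1 ≤ D ∧ ∀ k, |f k| ≤ C * D ^ k

lemma HasExpGrowth.add {f g : ℕ → ℝ} (hf : HasExpGrowth f) (hg : HasExpGrowth g) :
    HasExpGrowth (fun k => f k + g k) := by
  obtain ⟨C, D, hC, hD, h⟩ := hf
  obtain ⟨C', D', hC', hD', h'⟩ := hg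
  refine ⟨C + C', max D D', by positivity, le_max_of_le_left hD, fun k => ?_⟩
  calc |f k + g k| ≤ |f k| + |g k| := abs_add_le _ _
    _ ≤ C * D ^ k + C' * D' ^ k := add_le_add (h k) (h' k)
    _ ≤ C * (max D D') ^ k + C' * (max D D') ^ k := by
        gcongr
        · exact le_max_left _ _
        · exact le_max_right _ _
    _ = _ := by ring

lemma HasExpGrowth.const_mul {f : ℕ → ℝ} (c : ℝ) (hf : HasExpGrowth f) :
    HasExpGrowth (fun k => c * f k) := by
  obtain ⟨C, D, hC, hD, h⟩ := hf
  refine ⟨|c| * C, D, by positivity, hD, fun k => ?_⟩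
  rw [abs_mul, mul_assoc]
  exact mul_le_mul_of_nonneg_left (h k) (abs_nonneg _)

lemma HasExpGrowth.neg {f : ℕ → ℝ} (hf : HasExpGrowth f) : HasExpGrowth (fun k => -f k) := by
  simpa using hf.const_mul (-1)

lemma HasExpGrowth.sub {f g : ℕ → ℝ} (hf : HasExpGrowth f) (hg : HasExpGrowth g) :
    HasExpGrowth (fun k => f k - g k) := by
  simpa [sub_eq_add_neg] using hf.add hg.neg

lemma HasExpGrowth.shift {f : ℕ → ℝ} (hf : HasExpGrowth f) :
    HasExpGrowth (fun k => f (k + 1)) := by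
  obtain ⟨C, D, hC, hD, h⟩ := hf
  exact ⟨C * D, D, by positivity, hD, fun k => (h (k + 1)).trans_eq (by ring)⟩

lemma hasExpGrowth_natCast : HasExpGrowth (fun k => (k : ℝ)) := by
  refine ⟨1, 2, by norm_num, by norm_num, fun k => ?_⟩
  have : (k : ℝ) ≤ 2 ^ k := by exact_mod_cast k.lt_two_pow_self.le
  simpa using this

lemma hasExpGrowth_const (c : ℝ) : HasExpGrowth (fun _ => c) :=
  ⟨|c|, 1, abs_nonneg _, le_rfl, fun k => by simp⟩

lemma HasExpGrowth.mul {f g : ℕ → ℝ} (hf : HasExpGrowth f) (hg : HasExpGrowth g) :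
    HasExpGrowth (fun k => f k * g k) := by
  obtain ⟨C, D, hC, hD, h⟩ := hf
  obtain ⟨C', D', hC', hD', h'⟩ := hg
  refine ⟨C * C', D * D', by positivity, by nlinarith, fun k => ?_⟩
  calc |f k * g k| = |f k| * |g k| := abs_mul _ _
    _ ≤ (C * D ^ k) * (C' * D' ^ k) := by
        gcongr
        · exact h k
        · exact h' k
    _ = _ := by rw [mul_pow]; ring

lemma HasExpGrowth.pred {f : ℕ → ℝ} (hf : HasExpGrowth f) :
    HasExpGrowth (fun k => f (k - 1)) := by
  obtain ⟨C, D, hC, hD, h⟩ := hf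
  refine ⟨C, D, hC, hD, fun k => (h (k - 1)).trans ?_⟩
  gcongr
  omega

/-! ### Exponential generating functions and Poisson means. -/

/-- The exponential generating function of `f`. -/
noncomputable def egf (f : ℕ → ℝ) (t : ℝ) : ℝ := ∑' k : ℕ, t ^ k / k.factorial * f k

/-- The mean of `f` under the Poisson distribution with parameter `t`. -/
noncomputable def poissonMean (f : ℕ → ℝ) (t : ℝ) : ℝ := Real.exp (-t) * egf f t

lemma HasExpGrowth.summable_norm {f : ℕ → ℝ} (hf : HasExpGrowth f) (t : ℝ) :
    Summable (fun k : ℕ => |t| ^ k / k.factorial * |f k|) := by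
  obtain ⟨C, D, hC, hD, h⟩ := hf
  refine Summable.of_nonneg_of_le (fun k => by positivity) (fun k => ?_)
    ((Real.summable_pow_div_factorial (|t| * D)).mul_left C)
  calc |t| ^ k / k.factorial * |f k| ≤ |t| ^ k / k.factorial * (C * D ^ k) := by
        gcongr; exact h k
    _ = _ := by rw [mul_pow]; ring

lemma HasExpGrowth.summable {f : ℕ → ℝ} (hf : HasExpGrowth f) (t : ℝ) :
    Summable (fun k : ℕ => t ^ k / k.factorial * f k) := by
  refine Summable.of_norm ((hf.summable_norm t).congr fun k => ?_)
  simp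

lemma hasDerivAt_egf {f : ℕ → ℝ} (hf : HasExpGrowth f) (t : ℝ) :
    HasDerivAt (egf f) (egf (fun k => f (k + 1)) t) t := by
  -- The ball of radius `|t| + 1` contains `t`, and on it the differentiated series is dominated by
  -- its values at `R`.
  set R : ℝ := |t| + 1
  have hR : 0 < R := by positivity
  have key : ∀ (y : ℝ) (k : ℕ), ((k + 1 : ℕ) : ℝ) * y ^ (k + 1 - 1) / (k + 1).factorial * f (k + 1)
      = y ^ k / k.factorial * f (k + 1) := by
    intro y k
    rw [Nat.factorial_succ, Nat.add_sub_cancel]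
    push_cast
    have : ((k : ℝ) + 1) ≠ 0 := by positivity
    field_simp
  have hu : Summable (fun k : ℕ => (k : ℝ) * R ^ (k - 1) / k.factorial * |f k|) := by
    rw [← summable_nat_add_iff 1]
    refine (hf.shift.summable_norm R).congr fun k => ?_
    rw [abs_of_pos hR, Nat.factorial_succ, Nat.add_sub_cancel]
    push_cast
    have : ((k : ℝ) + 1) ≠ 0 := by positivity
    field_simp
  have hball : ∀ y ∈ Metric.ball (0 : ℝ) R, |y| ≤ R := fun y hy => by
    simpa using (Metric.mem_ball.1 hy).le
  have ht : t ∈ Metric.ball (0 : ℝ) R := by simp [R]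
  have h := hasDerivAt_tsum_of_isPreconnected (𝕜 := ℝ) (t := Metric.ball (0 : ℝ) R)
    (g := fun k y => y ^ k / k.factorial * f k)
    (g' := fun k y => (k : ℝ) * y ^ (k - 1) / k.factorial * f k) (y₀ := t) (y := t) hu
    Metric.isOpen_ball (convex_ball _ _).isPreconnected
    (fun k y _ => ((hasDerivAt_pow k y).div_const _).mul_const _)
    (fun k y hy => by
      rw [Real.norm_eq_abs, abs_mul, abs_div, abs_mul, abs_pow, Nat.abs_cast, Nat.abs_cast]
      gcongr
      exact hball y hy) ht (hf.summable t) ht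
  refine h.congr_deriv ?_
  have hs : Summable (fun k : ℕ => (k : ℝ) * t ^ (k - 1) / k.factorial * f k) := by
    rw [← summable_nat_add_iff 1]
    exact (hf.shift.summable t).congr fun k => (key t k).symm
  rw [hs.tsum_eq_zero_add]
  simp only [Nat.cast_zero, zero_mul, zero_div, zero_add, key]
  rfl

lemma egf_add {f g : ℕ → ℝ} (hf : HasExpGrowth f) (hg : HasExpGrowth g) (t : ℝ) :
    egf (fun k => f k + g k) t = egf f t + egf g t := by
  unfold egf
  rw [← (hf.summable t).tsum_add (hg.summable t)]
  exact tsum_congr fun k => by ring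

lemma egf_const_mul (c : ℝ) (f : ℕ → ℝ) (t : ℝ) :
    egf (fun k => c * f k) t = c * egf f t := by
  unfold egf
  rw [← tsum_mul_left]
  exact tsum_congr fun k => by ring

lemma egf_sub {f g : ℕ → ℝ} (hf : HasExpGrowth f) (hg : HasExpGrowth g) (t : ℝ) :
    egf (fun k => f k - g k) t = egf f t - egf g t := by
  unfold egf
  rw [← (hf.summable t).tsum_sub (hg.summable t)]
  exact tsum_congr fun k => by ring

lemma egf_one (t : ℝ) : egf (fun _ => 1) t = Real.exp t := by
  rw [Real.exp_eq_exp_ℝ, NormedSpace.exp_eq_tsum_div]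
  simp [egf]

/-- The size-biasing identity `t E f(N) = E N f(N - 1)`. -/
lemma mul_egf {f : ℕ → ℝ} (hf : HasExpGrowth f) (t : ℝ) :
    t * egf f t = egf (fun k => k * f (k - 1)) t := by
  unfold egf
  rw [((hasExpGrowth_natCast.mul hf.pred).summable t).tsum_eq_zero_add, ← tsum_mul_left]
  -- The truncated value `f (0 - 1)` is harmless, being multiplied by the factor `k = 0`.
  simp only [Nat.cast_zero, zero_mul, mul_zero, zero_add, Nat.add_sub_cancel]
  refine tsum_congr fun k => ?_
  rw [Nat.factorial_succ]
  push_cast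
  have : ((k : ℝ) + 1) ≠ 0 := by positivity
  field_simp
  ring

lemma egf_natCast (t : ℝ) : egf (fun k => (k : ℝ)) t = t * Real.exp t := by
  rw [← egf_one, mul_egf (hasExpGrowth_const 1)]
  simp

/-- Terms from `K` on are bounded by an affine function, whose generating function is known. -/
lemma egf_le_of_le_affine {f : ℕ → ℝ} (hf : HasExpGrowth f) (K : ℕ) (A B : ℝ)
    (h : ∀ k, K ≤ k → f k ≤ A + B * k) {t : ℝ} (ht : 0 ≤ t) :
    egf f t ≤ (A + B * t) * Real.exp t
      + ∑ k ∈ Finset.range K, t ^ k / k.factorial * (f k - (A + B * k)) := by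
  have hB : HasExpGrowth (fun k => B * (k : ℝ)) := hasExpGrowth_natCast.const_mul B
  have hl : HasExpGrowth (fun k => A + B * (k : ℝ)) := (hasExpGrowth_const A).add hB
  have h1 : egf (fun k => A + B * (k : ℝ)) t = (A + B * t) * Real.exp t := by
    rw [egf_add (hasExpGrowth_const A) hB, egf_const_mul, egf_natCast]
    have := egf_const_mul A (fun _ => 1) t
    simp only [mul_one] at this
    rw [this, egf_one]; ring
  have h2 := egf_sub hf hl t
  have h3 : egf (fun k => f k - (A + B * k)) t
      ≤ ∑ k ∈ Finset.range K, t ^ k / k.factorial * (f k - (A + B * k)) := by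
    unfold egf
    rw [← ((hf.sub hl).summable t).sum_add_tsum_nat_add K]
    have : ∑' i : ℕ, t ^ (i + K) / (i + K).factorial * (f (i + K) - (A + B * (i + K : ℕ))) ≤ 0 :=
      tsum_nonpos fun i => mul_nonpos_of_nonneg_of_nonpos (by positivity)
        (by linarith [h (i + K) (by omega)])
    linarith
  linarith

lemma le_egf_of_affine_le {f : ℕ → ℝ} (hf : HasExpGrowth f) (K : ℕ) (A B : ℝ)
    (h : ∀ k, K ≤ k → A + B * k ≤ f k) {t : ℝ} (ht : 0 ≤ t) :
    (A + B * t) * Real.exp t + ∑ k ∈ Finset.range K, t ^ k / k.factorial * (f k - (A + B * k))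
      ≤ egf f t := by
  have := egf_le_of_le_affine hf.neg K (-A) (-B) (fun k hk => by linarith [h k hk]) ht
  have h2 := egf_const_mul (-1) f t
  simp only [neg_mul, one_mul] at h2
  rw [h2] at this
  have h3 : ∑ k ∈ Finset.range K, t ^ k / k.factorial * (-f k - (-A + -B * k))
      = -∑ k ∈ Finset.range K, t ^ k / k.factorial * (f k - (A + B * k)) := by
    rw [← Finset.sum_neg_distrib]
    exact Finset.sum_congr rfl fun k _ => by ring
  rw [h3] at this
  linarith

/-- Differentiating `exp (-t)` subtracts the sequence from its shift. Derivatives of the Poisson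
loss thereby remain Poisson means of explicit sequences. -/
lemma hasDerivAt_poissonMean {f : ℕ → ℝ} (hf : HasExpGrowth f) (t : ℝ) :
    HasDerivAt (poissonMean f) (poissonMean (fun k => f (k + 1) - f k) t) t := by
  have h1 : HasDerivAt (fun t : ℝ => Real.exp (-t)) (-Real.exp (-t)) t := by
    simpa using (hasDerivAt_neg t).exp
  refine (h1.mul (hasDerivAt_egf hf t)).congr_deriv ?_
  rw [poissonMean, egf_sub hf.shift hf]
  ring

lemma exp_neg_mul_exp (t : ℝ) : Real.exp (-t) * Real.exp t = 1 := by
  rw [← Real.exp_add]; simp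

/-! ### The Poisson loss and its first two derivatives. -/

/-- The weight `r + β_r` of a letter seen `r` times. -/
noncomputable def countWeight (r : ℕ) : ℝ := r + addConst r

lemma addConst_le_one (r : ℕ) : addConst r ≤ 1 := by
  unfold addConst; split_ifs <;> norm_num

lemma half_le_addConst (r : ℕ) : 1 / 2 ≤ addConst r := by
  unfold addConst; split_ifs <;> norm_num

lemma countWeight_pos (r : ℕ) : 0 < countWeight r :=
  add_pos_of_nonneg_of_pos r.cast_nonneg (addConst_pos r)

lemma half_le_countWeight (r : ℕ) : 1 / 2 ≤ countWeight r := by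
  have := half_le_addConst r
  have : (0 : ℝ) ≤ r := r.cast_nonneg
  unfold countWeight; linarith

lemma countWeight_le (r : ℕ) : countWeight r ≤ r + 1 := by
  have := addConst_le_one r
  unfold countWeight; linarith

lemma abs_log_countWeight_le (r : ℕ) : |Real.log (countWeight r)| ≤ r + 1 := by
  have h := half_le_countWeight r
  have h0 : (0 : ℝ) ≤ r := r.cast_nonneg
  rw [abs_le]
  constructor
  · have := Real.one_sub_inv_le_log_of_pos (countWeight_pos r)
    have h2 : (countWeight r)⁻¹ ≤ 2 := by
      rw [inv_le_comm₀ (countWeight_pos r) two_pos]; linarith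
    linarith
  · have := Real.log_le_sub_one_of_pos (countWeight_pos r)
    have := countWeight_le r
    linarith

lemma hasExpGrowth_log_countWeight : HasExpGrowth (fun k => Real.log (countWeight k)) := by
  refine ⟨1, 2, by norm_num, by norm_num, fun k => (abs_log_countWeight_le k).trans ?_⟩
  have : ((k + 1 : ℕ) : ℝ) ≤ ((2 ^ k : ℕ) : ℝ) := Nat.cast_le.2 k.lt_two_pow_self
  push_cast at this
  linarith

lemma hasExpGrowth_addConst : HasExpGrowth addConst :=
  ⟨1, 1, by norm_num, le_rfl, fun k => by
    rw [abs_of_pos (addConst_pos k)]; simpa using addConst_le_one k⟩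

/-- The sequence whose Poisson mean is `t E log (N + β_N) - E β_N`. -/
noncomputable def lossSeq (k : ℕ) : ℝ := k * Real.log (countWeight (k - 1)) - addConst k

/-- The first difference of `lossSeq`. -/
noncomputable def lossSeqDiff (k : ℕ) : ℝ := lossSeq (k + 1) - lossSeq k

/-- `1 - k Δ² lossSeq (k - 1)`, whose Poisson mean is `t` times the second derivative of the loss. -/
noncomputable def curvSeq (k : ℕ) : ℝ := 1 - k * (lossSeqDiff (k - 1 + 1) - lossSeqDiff (k - 1))

lemma hasExpGrowth_lossSeq : HasExpGrowth lossSeq :=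
  (hasExpGrowth_natCast.mul hasExpGrowth_log_countWeight.pred).sub hasExpGrowth_addConst

lemma hasExpGrowth_lossSeqDiff : HasExpGrowth lossSeqDiff :=
  hasExpGrowth_lossSeq.shift.sub hasExpGrowth_lossSeq

lemma hasExpGrowth_lossSeqDiff2 : HasExpGrowth (fun k => lossSeqDiff (k + 1) - lossSeqDiff k) :=
  hasExpGrowth_lossSeqDiff.shift.sub hasExpGrowth_lossSeqDiff

lemma hasExpGrowth_curvSeq : HasExpGrowth curvSeq :=
  (hasExpGrowth_const 1).sub (hasExpGrowth_natCast.mul hasExpGrowth_lossSeqDiff2.pred)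

/-- The normalised loss of a letter whose number of occurrences is Poisson with mean `t`. -/
noncomputable def poissonLoss (t : ℝ) : ℝ :=
  t * Real.log t - t * poissonMean (fun k => Real.log (countWeight k)) t + poissonMean addConst t

lemma poissonLoss_eq (t : ℝ) : poissonLoss t = t * Real.log t - poissonMean lossSeq t := by
  have h1 := mul_egf hasExpGrowth_log_countWeight t
  have h2 : egf lossSeq t = egf (fun k => k * Real.log (countWeight (k - 1))) t - egf addConst t :=
    egf_sub (hasExpGrowth_natCast.mul hasExpGrowth_log_countWeight.pred) hasExpGrowth_addConst t
  rw [poissonLoss, poissonMean, poissonMean, poissonMean, h2, ← h1]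
  ring

/-- The derivative of `poissonLoss`. -/
noncomputable def poissonLossDeriv (t : ℝ) : ℝ := Real.log t + 1 - poissonMean lossSeqDiff t

lemma hasDerivAt_poissonLoss {t : ℝ} (ht : 0 < t) :
    HasDerivAt poissonLoss (poissonLossDeriv t) t := by
  have h := (Real.hasDerivAt_mul_log ht.ne').sub (hasDerivAt_poissonMean hasExpGrowth_lossSeq t)
  exact h.congr_of_eventuallyEq (Eventually.of_forall poissonLoss_eq)

lemma hasDerivAt_poissonLossDeriv {t : ℝ} (ht : 0 < t) :
    HasDerivAt poissonLossDeriv (Real.exp (-t) * egf curvSeq t / t) t := by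
  have h := ((Real.hasDerivAt_log ht.ne').add_const 1).sub
    (hasDerivAt_poissonMean hasExpGrowth_lossSeqDiff t)
  refine h.congr_deriv ?_
  have h1 := mul_egf hasExpGrowth_lossSeqDiff2 t
  have h2 : egf curvSeq t = egf (fun _ => 1) t
      - egf (fun k => k * (lossSeqDiff (k - 1 + 1) - lossSeqDiff (k - 1))) t :=
    egf_sub (hasExpGrowth_const 1) (hasExpGrowth_natCast.mul hasExpGrowth_lossSeqDiff2.pred) t
  have h3 := exp_neg_mul_exp t
  rw [poissonMean, h2, egf_one, ← h1, mul_sub, h3]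
  field_simp

lemma continuous_egf {f : ℕ → ℝ} (hf : HasExpGrowth f) : Continuous (egf f) :=
  continuous_iff_continuousAt.2 fun t => (hasDerivAt_egf hf t).continuousAt

lemma continuous_poissonLoss : Continuous poissonLoss := by
  have h : poissonLoss = fun t => t * Real.log t - poissonMean lossSeq t := funext poissonLoss_eq
  rw [h]
  refine Real.continuous_mul_log.sub ?_
  exact (Real.continuous_exp.comp continuous_neg).mul (continuous_egf hasExpGrowth_lossSeq)

/-- A Taylor bound for a function whose second derivative is at most `M`. -/
lemma le_taylor_of_deriv2_le {f f' f'' : ℝ → ℝ} {a b c M : ℝ}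
    (hf : ∀ x ∈ Set.Icc a b, HasDerivAt f (f' x) x)
    (hf' : ∀ x ∈ Set.Icc a b, HasDerivAt f' (f'' x) x)
    (hM : ∀ x ∈ Set.Icc a b, f'' x ≤ M) (hc : c ∈ Set.Icc a b) {x : ℝ} (hx : x ∈ Set.Icc a b) :
    f x ≤ f c + f' c * (x - c) + M / 2 * (x - c) ^ 2 := by
  -- The derivative of the remainder `g` is antitone and vanishes at `c`, so `g` has its maximum
  -- over the interval at `c`.
  set g : ℝ → ℝ := fun y => f y - f' c * (y - c) - M / 2 * (y - c) ^ 2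
  set g' : ℝ → ℝ := fun y => f' y - f' c - M * (y - c)
  have hg : ∀ y ∈ Set.Icc a b, HasDerivAt g (g' y) y := fun y hy => by
    have h1 := ((hasDerivAt_id y).sub_const c).const_mul (f' c)
    have h2 := (((hasDerivAt_id y).sub_const c).pow 2).const_mul (M / 2)
    refine (((hf y hy).sub h1).sub h2).congr_deriv ?_
    simp only [g', id]; ring
  have hg' : ∀ y ∈ Set.Icc a b, HasDerivAt g' (f'' y - M) y := fun y hy => by
    have h1 := ((hasDerivAt_id y).sub_const c).const_mul M
    refine (((hf' y hy).sub_const (f' c)).sub h1).congr_deriv ?_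
    ring
  have hanti : AntitoneOn g' (Set.Icc a b) := by
    refine antitoneOn_of_hasDerivWithinAt_nonpos (f' := fun y => f'' y - M) (convex_Icc a b)
      (fun y hy => (hg' y hy).continuousAt.continuousWithinAt)
      (fun y hy => (hg' y (interior_subset hy)).hasDerivWithinAt)
      (fun y hy => by linarith [hM y (interior_subset hy)])
  have hgc : g' c = 0 := by simp [g']
  have hfin : g x ≤ g c := by
    rcases le_total x c with h | h
    · refine monotoneOn_of_hasDerivWithinAt_nonneg (f := g) (f' := g') (convex_Icc x c)
        (fun y hy => (hg y ⟨hx.1.trans hy.1, hy.2.trans hc.2⟩).continuousAt.continuousWithinAt)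
        (fun y hy => ?_) (fun y hy => ?_) ⟨le_rfl, h⟩ ⟨h, le_rfl⟩ h
      · have hy := interior_subset hy
        exact (hg y ⟨hx.1.trans hy.1, hy.2.trans hc.2⟩).hasDerivWithinAt
      · have hy := interior_subset hy
        rw [← hgc]
        exact hanti ⟨hx.1.trans hy.1, hy.2.trans hc.2⟩ hc hy.2
    · refine antitoneOn_of_hasDerivWithinAt_nonpos (f := g) (f' := g') (convex_Icc c x)
        (fun y hy => (hg y ⟨hc.1.trans hy.1, hy.2.trans hx.2⟩).continuousAt.continuousWithinAt)
        (fun y hy => ?_) (fun y hy => ?_) ⟨le_rfl, h⟩ ⟨h, le_rfl⟩ h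
      · have hy := interior_subset hy
        exact (hg y ⟨hc.1.trans hy.1, hy.2.trans hx.2⟩).hasDerivWithinAt
      · have hy := interior_subset hy
        rw [← hgc]
        exact hanti hc ⟨hc.1.trans hy.1, hy.2.trans hx.2⟩ hy.1
  simp only [g, sub_self, mul_zero, sub_zero, ne_eq, OfNat.ofNat_ne_zero, not_false_eq_true,
    zero_pow] at hfin
  linarith

/-! ### Signs and numerical values of the curvature coefficients. -/

lemma countWeight_add_two (k : ℕ) : countWeight (k + 2) = k + 11 / 4 := by
  simp [countWeight, addConst]; ring

lemma lossSeq_zero : lossSeq 0 = -(1 / 2) := by simp [lossSeq, addConst]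

lemma lossSeq_one : lossSeq 1 = -Real.log 2 - 1 := by simp [lossSeq, countWeight, addConst]

lemma lossSeq_two : lossSeq 2 = 2 * Real.log 2 - 3 / 4 := by
  simp [lossSeq, countWeight, addConst]; norm_num

lemma lossSeq_add_three (k : ℕ) :
    lossSeq (k + 3) = (k + 3) * Real.log (k + 11 / 4) - 3 / 4 := by
  have h : k + 3 - 1 = k + 2 := by omega
  rw [lossSeq, h, countWeight_add_two]
  simp [addConst]

lemma lossSeq_of_three_le {k : ℕ} (hk : 3 ≤ k) :
    lossSeq k = k * Real.log (k - 1 / 4) - 3 / 4 := by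
  obtain ⟨j, rfl⟩ := Nat.exists_eq_add_of_le' hk
  rw [lossSeq_add_three]
  push_cast
  congr 3
  ring

lemma curvSeq_zero : curvSeq 0 = 1 := by simp [curvSeq]

lemma curvSeq_succ (k : ℕ) :
    curvSeq (k + 1) = 1 - (k + 1) * (lossSeq (k + 2) - 2 * lossSeq (k + 1) + lossSeq k) := by
  rw [curvSeq, Nat.add_sub_cancel, lossSeqDiff, lossSeqDiff]
  push_cast
  ring

/-- From index 3 on, `lossSeq` is `k log (k - 1/4) - 3/4`, whose second difference slightly exceeds
`1 / k` at the centre. The surplus is of relative order `1 / k ^ 2`, so the series have to be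
expanded beyond the leading terms. -/
lemma curvSeq_nonpos {k : ℕ} (hk : 4 ≤ k) : curvSeq k ≤ 0 := by
  obtain ⟨j, rfl⟩ := Nat.exists_eq_add_of_le' (show 1 ≤ k by omega)
  rw [curvSeq_succ, lossSeq_of_three_le (by omega), lossSeq_of_three_le (by omega),
    lossSeq_of_three_le (by omega)]
  have hj : (3 : ℝ) ≤ j := by exact_mod_cast (by omega : 3 ≤ j)
  push_cast
  -- With `u = j + 3/4` the three logarithms have arguments `u (1 - t)`, `u` and `u (1 + t)`.
  obtain ⟨t, ht⟩ : ∃ t : ℝ, t = 1 / (j + 3 / 4) := ⟨_, rfl⟩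
  have hu : (0 : ℝ) < j + 3 / 4 := by linarith
  have ht0 : 0 < t := by rw [ht]; positivity
  have ht1 : t ≤ 4 / 15 := by rw [ht, div_le_div_iff₀ hu (by norm_num)]; linarith
  have hut : (j + 3 / 4 : ℝ) * t = 1 := by rw [ht]; field_simp
  have e1 : Real.log ((j : ℝ) + 2 - 1 / 4) = Real.log (j + 3 / 4) + Real.log (1 + t) := by
    rw [← Real.log_mul hu.ne' (by positivity)]
    congr 1
    linear_combination -hut
  have e2 : Real.log ((j : ℝ) - 1 / 4) = Real.log (j + 3 / 4) + Real.log (1 - t) := by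
    rw [← Real.log_mul hu.ne' (by linarith)]
    congr 1
    linear_combination hut
  have e3 : (j : ℝ) + 1 - 1 / 4 = j + 3 / 4 := by ring
  rw [e1, e2, e3]
  have h1 := Real.sum_range_le_log_div ht0.le (by linarith) 2
  rw [Real.log_div (by positivity) (by linarith)] at h1
  norm_num [Finset.sum_range_succ] at h1
  have h2 := Real.abs_log_sub_add_sum_range_le (x := t ^ 2)
    (by rw [abs_of_pos (by positivity)]; nlinarith) 3
  rw [abs_le, abs_of_pos (by positivity : 0 < t ^ 2)] at h2
  have h3 := h2.1
  have hl : Real.log (1 - t ^ 2) = Real.log (1 + t) + Real.log (1 - t) := by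
    rw [← Real.log_mul (by positivity) (by linarith)]
    congr 1
    ring
  rw [hl] at h3
  norm_num [Finset.sum_range_succ] at h3
  have h4 : (t ^ 2) ^ 4 / (1 - t ^ 2) ≤ 2 * t ^ 8 := by
    rw [div_le_iff₀ (by nlinarith)]
    have : 0 ≤ t ^ 8 := by positivity
    nlinarith [mul_nonneg this (by nlinarith : 0 ≤ 1 - 2 * t ^ 2)]
  obtain ⟨a, ha⟩ : ∃ a, a = Real.log (1 + t) + Real.log (1 - t) := ⟨_, rfl⟩
  obtain ⟨b, hb⟩ : ∃ b, b = Real.log (1 + t) - Real.log (1 - t) := ⟨_, rfl⟩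
  have ha' : -t ^ 2 - t ^ 4 / 2 - t ^ 6 / 3 - 2 * t ^ 8 ≤ a := by rw [ha]; nlinarith
  have hb' : 2 * t + 2 * t ^ 3 / 3 ≤ b := by rw [hb]; linarith
  -- In the second difference the terms with `log u` cancel, leaving only `a = log (1 - t²)` and `b
  -- = log ((1 + t) / (1 - t))`.
  have key : (j + 2) * (Real.log (j + 3 / 4) + Real.log (1 + t)) - 3 / 4
      - 2 * ((j + 1) * Real.log (j + 3 / 4) - 3 / 4)
      + (j * (Real.log (j + 3 / 4) + Real.log (1 - t)) - 3 / 4) = (j + 1) * a + b := by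
    rw [ha, hb]; ring
  rw [key]
  have hk1 : ((j : ℝ) + 1) * t = 1 + t / 4 := by linear_combination hut
  have hk0 : (0 : ℝ) < j + 1 := by linarith
  have h5 : 1 ≤ (j + 1) * ((j + 1) * (-t ^ 2 - t ^ 4 / 2 - t ^ 6 / 3 - 2 * t ^ 8)
      + (2 * t + 2 * t ^ 3 / 3)) := by
    have : (j + 1) * ((j + 1) * (-t ^ 2 - t ^ 4 / 2 - t ^ 6 / 3 - 2 * t ^ 8)
      + (2 * t + 2 * t ^ 3 / 3)) = (1 + t / 4) ^ 2 * (-1 - t ^ 2 / 2 - t ^ 4 / 3 - 2 * t ^ 6)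
        + (1 + t / 4) * (2 + 2 * t ^ 2 / 3) := by
      rw [← hk1]; ring
    rw [this]
    -- The constant terms cancel exactly. The leading surplus `5/48 = 1/6 - 1/16` outweighs the rest
    -- since `t ≤ 4/15`.
    have : 0 ≤ t ^ 2 * (5 / 48 - t / 12 - (1 / 32 + 1 / 3 * (1 + t / 4) ^ 2) * t ^ 2
        - 2 * (1 + t / 4) ^ 2 * t ^ 4) := by
      refine mul_nonneg (by positivity) ?_
      have s1 : t ^ 2 ≤ (4 / 15) ^ 2 := by gcongr
      have s2 : t ^ 4 ≤ (4 / 15) ^ 4 := by gcongr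
      have s3 : (1 + t / 4) ^ 2 ≤ (1 + 4 / 15 / 4) ^ 2 := by gcongr
      have s4 : (1 + t / 4) ^ 2 * t ^ 2 ≤ (1 + 4 / 15 / 4) ^ 2 * (4 / 15) ^ 2 := by gcongr
      have s5 : (1 + t / 4) ^ 2 * t ^ 4 ≤ (1 + 4 / 15 / 4) ^ 2 * (4 / 15) ^ 4 := by gcongr
      nlinarith
    nlinarith
  have h6 : (j + 1) * ((j + 1) * (-t ^ 2 - t ^ 4 / 2 - t ^ 6 / 3 - 2 * t ^ 8)
      + (2 * t + 2 * t ^ 3 / 3)) ≤ (j + 1) * ((j + 1) * a + b) := by gcongr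
  linarith

/-- Two terms of the artanh series with `t = (b - a) / (b + a)`. It transfers known decimals of `log
b` to a nearby `log a`. -/
lemma log_bounds_of_ratio {a b t : ℝ} (ha : 0 < a) (hb : 0 < b) (h₀ : 0 ≤ t) (h : t < 1)
    (hab : b / a = (1 + t) / (1 - t)) :
    Real.log b - 2 * (t + t ^ 3 / 3 + t ^ 5 / (1 - t ^ 2)) ≤ Real.log a ∧
      Real.log a ≤ Real.log b - 2 * (t + t ^ 3 / 3) := by
  have h1 := Real.sum_range_le_log_div h₀ h 2
  have h2 := Real.log_div_le_sum_range_add h₀ h 2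
  rw [← hab, Real.log_div hb.ne' ha.ne'] at h1 h2
  norm_num [Finset.sum_range_succ] at h1 h2
  constructor <;> linarith

lemma log_four : Real.log 4 = 2 * Real.log 2 := by
  rw [show (4 : ℝ) = 2 ^ 2 by norm_num, Real.log_pow]; norm_num

lemma log_eleven_fourths : 1.011600 < Real.log (11 / 4) ∧ Real.log (11 / 4) < 1.011602 := by
  have h := log_bounds_of_ratio (a := 11 / 4) (b := 3) (t := 1 / 23) (by norm_num) (by norm_num)
    (by norm_num) (by norm_num) (by norm_num)
  have := Real.log_three_gt_d9
  have := Real.log_three_lt_d9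
  norm_num at h ⊢
  constructor <;> linarith

lemma log_fifteen_fourths : 1.321755 < Real.log (15 / 4) ∧ Real.log (15 / 4) < 1.321757 := by
  have h : Real.log (15 / 4) = Real.log 3 + Real.log 5 - 2 * Real.log 2 := by
    rw [← log_four, ← Real.log_mul (by norm_num) (by norm_num),
      ← Real.log_div (by norm_num) (by norm_num)]
    norm_num
  have := Real.log_three_gt_d9
  have := Real.log_three_lt_d9
  have := Real.log_five_gt_d9
  have := Real.log_five_lt_d9
  have := Real.log_two_gt_d9
  have := Real.log_two_lt_d9
  rw [h]
  constructor <;> linarith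

lemma log_nineteen_fourths : 1.558143 < Real.log (19 / 4) ∧ Real.log (19 / 4) < 1.558146 := by
  have h := log_bounds_of_ratio (a := 19 / 4) (b := 5) (t := 1 / 39) (by norm_num) (by norm_num)
    (by norm_num) (by norm_num) (by norm_num)
  have := Real.log_five_gt_d9
  have := Real.log_five_lt_d9
  norm_num at h ⊢
  constructor <;> linarith

lemma log_twentythree_fourths :
    1.749198 < Real.log (23 / 4) ∧ Real.log (23 / 4) < 1.749201 := by
  have h := log_bounds_of_ratio (a := 23 / 4) (b := 6) (t := 1 / 47) (by norm_num) (by norm_num)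
    (by norm_num) (by norm_num) (by norm_num)
  have h6 : Real.log 6 = Real.log 2 + Real.log 3 := by
    rw [← Real.log_mul (by norm_num) (by norm_num)]; norm_num
  rw [h6] at h
  have := Real.log_three_gt_d9
  have := Real.log_three_lt_d9
  have := Real.log_two_gt_d9
  have := Real.log_two_lt_d9
  norm_num at h ⊢
  constructor <;> linarith

lemma log_twentyseven_fourths :
    1.909542 < Real.log (27 / 4) ∧ Real.log (27 / 4) < 1.909543 := by
  have h : Real.log (27 / 4) = 3 * Real.log 3 - 2 * Real.log 2 := by
    rw [← log_four, Real.log_div (by norm_num) (by norm_num),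
      show (27 : ℝ) = 3 ^ 3 by norm_num, Real.log_pow]
    norm_num
  have := Real.log_three_gt_d9
  have := Real.log_three_lt_d9
  have := Real.log_two_gt_d9
  have := Real.log_two_lt_d9
  rw [h]
  constructor <;> linarith

lemma lossSeq_three : lossSeq 3 = 3 * Real.log (11 / 4) - 3 / 4 := by
  have := lossSeq_add_three 0; norm_num at this; exact this

lemma lossSeq_four : lossSeq 4 = 4 * Real.log (15 / 4) - 3 / 4 := by
  have := lossSeq_add_three 1; norm_num at this; exact this

lemma lossSeq_five : lossSeq 5 = 5 * Real.log (19 / 4) - 3 / 4 := by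
  have := lossSeq_add_three 2; norm_num at this; exact this

lemma lossSeq_six : lossSeq 6 = 6 * Real.log (23 / 4) - 3 / 4 := by
  have := lossSeq_add_three 3; norm_num at this; exact this

lemma lossSeq_seven : lossSeq 7 = 7 * Real.log (27 / 4) - 3 / 4 := by
  have := lossSeq_add_three 4; norm_num at this; exact this

lemma curvSeq_one_bounds : -2.5226 < curvSeq 1 ∧ curvSeq 1 < -2.5225 := by
  have h := curvSeq_succ 0
  norm_num [lossSeq_zero, lossSeq_one, lossSeq_two] at h
  have := Real.log_two_gt_d9
  have := Real.log_two_lt_d9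
  rw [h]
  constructor <;> linarith

lemma curvSeq_two_bounds : 2.3618 < curvSeq 2 ∧ curvSeq 2 < 2.3619 := by
  have h := curvSeq_succ 1
  norm_num [lossSeq_three, lossSeq_one, lossSeq_two] at h
  have := Real.log_two_gt_d9
  have := Real.log_two_lt_d9
  have := log_eleven_fourths
  rw [h]
  constructor <;> linarith

lemma curvSeq_three_bounds : -0.8112 < curvSeq 3 ∧ curvSeq 3 < -0.8111 := by
  have h := curvSeq_succ 2
  norm_num [lossSeq_three, lossSeq_four, lossSeq_two] at h
  have := Real.log_two_gt_d9
  have := Real.log_two_lt_d9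
  have := log_eleven_fourths
  have := log_fifteen_fourths
  rw [h]
  constructor <;> linarith

/-- The terms from index 4 on are nonpositive and are dropped. -/
lemma egf_curvSeq_le {t : ℝ} (ht : 0 ≤ t) :
    egf curvSeq t ≤ 1 - 2.5225 * t + 1.18095 * t ^ 2 - 0.13518 * t ^ 3 := by
  have h := egf_le_of_le_affine hasExpGrowth_curvSeq 4 0 0
    (fun k hk => by simpa using curvSeq_nonpos hk) ht
  norm_num [Finset.sum_range_succ, curvSeq_zero, Nat.factorial] at h
  have h1 : t * curvSeq 1 ≤ t * -2.5225 := by gcongr; exact curvSeq_one_bounds.2.le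
  have h2 : t ^ 2 / 2 * curvSeq 2 ≤ t ^ 2 / 2 * 2.3619 := by gcongr; exact curvSeq_two_bounds.2.le
  have h3 : t ^ 3 / 6 * curvSeq 3 ≤ t ^ 3 / 6 * -0.8111 := by
    gcongr; exact curvSeq_three_bounds.2.le
  have : 0 ≤ t ^ 3 := by positivity
  linarith

/-- The right side is `0.009 t` times a truncation of `exp t`, so this makes the second derivative
of `poissonLoss` at most 0.009 on the middle range. -/
lemma curv_poly_le {t : ℝ} (h1 : 0.55 ≤ t) (h2 : t ≤ 3.65) :
    1 - 2.5225 * t + 1.18095 * t ^ 2 - 0.13518 * t ^ 3 ≤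
      0.009 * t * (1 + t + t ^ 2 / 2 + t ^ 3 / 6 + t ^ 4 / 24 + t ^ 5 / 120) := by
  rcases le_total t 2.4 with h | h
  · have : 0 ≤ t ^ 2 := by positivity
    nlinarith [mul_nonneg (sub_nonneg.2 h1) (sub_nonneg.2 h),
      mul_nonneg (mul_nonneg (sub_nonneg.2 h1) (sub_nonneg.2 h)) (by linarith : 0 ≤ t),
      (by positivity : 0 ≤ t ^ 3 / 6 + t ^ 4 / 24 + t ^ 5 / 120)]
  · obtain ⟨s, rfl⟩ : ∃ s, t = 3 + s := ⟨t - 3, by ring⟩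
    have a1 : -0.6 ≤ s := by linarith
    have a2 : s ≤ 0.65 := by linarith
    nlinarith [sq_nonneg s, sq_nonneg (s ^ 2), sq_nonneg (s ^ 3),
      mul_nonneg (sub_nonneg.2 a1) (sub_nonneg.2 a2),
      mul_nonneg (mul_nonneg (sub_nonneg.2 a1) (sub_nonneg.2 a2)) (sq_nonneg s),
      sq_nonneg (s * (s - 1)), sq_nonneg (s * (s + 1))]

/-! ### Value and slope of the Poisson loss at 2. -/

lemma lossSeqDiff_eq {k : ℕ} (hk : 3 ≤ k) :
    lossSeqDiff k = Real.log (k + 3 / 4)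
      + k * (Real.log (k + 3 / 4) - Real.log (k - 1 / 4)) := by
  rw [lossSeqDiff, lossSeq_of_three_le (by omega), lossSeq_of_three_le hk]
  have : ((k + 1 : ℕ) : ℝ) - 1 / 4 = k + 3 / 4 := by push_cast; ring
  rw [this]
  push_cast
  ring

lemma le_lossSeqDiff {k : ℕ} (hk : 7 ≤ k) : 2.94 ≤ lossSeqDiff k := by
  rw [lossSeqDiff_eq (by omega)]
  have hk' : (7 : ℝ) ≤ k := by exact_mod_cast hk
  have h1 := Real.one_sub_inv_le_log_of_pos (x := (k + 3 / 4 : ℝ) / (27 / 4)) (by positivity)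
  rw [Real.log_div (by positivity) (by norm_num)] at h1
  have h2 := Real.one_sub_inv_le_log_of_pos (x := (k + 3 / 4 : ℝ) / (k - 1 / 4))
    (div_pos (by linarith) (by linarith))
  rw [Real.log_div (by positivity) (by linarith)] at h2
  have h3 : ((k + 3 / 4 : ℝ) / (27 / 4))⁻¹ ≤ 27 / 31 := by
    rw [inv_div, div_le_div_iff₀ (by positivity) (by norm_num)]; linarith
  have h4 : 28 / 31 ≤ k * (Real.log (k + 3 / 4) - Real.log (k - 1 / 4)) := by
    refine le_trans ?_ (mul_le_mul_of_nonneg_left h2 (by positivity))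
    rw [inv_div, one_sub_div (by positivity), mul_div_assoc', div_le_div_iff₀ (by norm_num)
      (by positivity)]
    nlinarith
  have := log_twentyseven_fourths.1
  linarith

/-- The slope is that of the tangent to the logarithm at `27/4`, namely `4/27`, rounded up. The
affine form allows the tail of the Poisson mean to be summed in closed form. -/
lemma lossSeqDiff_le {k : ℕ} (hk : 7 ≤ k) : lossSeqDiff k ≤ 2.0578 + 0.14815 * k := by
  rw [lossSeqDiff_eq (by omega)]
  have hk' : (7 : ℝ) ≤ k := by exact_mod_cast hk
  have h1 := Real.log_le_sub_one_of_pos (x := (k + 3 / 4 : ℝ) / (27 / 4)) (by positivity)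
  rw [Real.log_div (by positivity) (by norm_num)] at h1
  have h2 := Real.log_le_sub_one_of_pos (x := (k + 3 / 4 : ℝ) / (k - 1 / 4))
    (div_pos (by linarith) (by linarith))
  rw [Real.log_div (by positivity) (by linarith)] at h2
  have h4 : k * (Real.log (k + 3 / 4) - Real.log (k - 1 / 4)) ≤ 28 / 27 := by
    refine le_trans (mul_le_mul_of_nonneg_left h2 (by positivity)) ?_
    rw [div_sub_one (by linarith), mul_div_assoc', div_le_div_iff₀ (by linarith) (by norm_num)]
    nlinarith
  have := log_twentyseven_fourths.2
  linarith

lemma le_lossSeq {k : ℕ} (hk : 7 ≤ k) : -7.97 + 2.94 * k ≤ lossSeq k := by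
  induction k, hk using Nat.le_induction with
  | base =>
    rw [lossSeq_seven]
    have := log_twentyseven_fourths.1
    norm_num
    linarith
  | succ k hk ih =>
    have := le_lossSeqDiff hk
    rw [lossSeqDiff] at this
    push_cast
    linarith

lemma exp_two_bounds : 7.38905 < Real.exp 2 ∧ Real.exp 2 < 7.38906 := by
  have h : Real.exp 2 = Real.exp 1 * Real.exp 1 := by rw [← Real.exp_add]; norm_num
  have := Real.exp_one_gt_d9
  have := Real.exp_one_lt_d9
  rw [h]
  constructor <;> nlinarith

lemma le_of_exp_neg_mul {x y t : ℝ} (h : x * Real.exp t ≤ y) : x ≤ Real.exp (-t) * y := by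
  rw [Real.exp_neg, inv_mul_eq_div, le_div_iff₀ (Real.exp_pos t)]
  exact h

lemma exp_neg_mul_le_of {x y t : ℝ} (h : y ≤ x * Real.exp t) : Real.exp (-t) * y ≤ x := by
  rw [Real.exp_neg, inv_mul_eq_div, div_le_iff₀ (Real.exp_pos t)]
  exact h

lemma poissonLoss_two_le : poissonLoss 2 ≤ 0.4859 := by
  rw [poissonLoss_eq]
  have h := le_egf_of_affine_le hasExpGrowth_lossSeq 7 (-7.97) 2.94 (fun k hk => le_lossSeq hk)
    (t := 2) (by norm_num)
  norm_num [Finset.sum_range_succ, Nat.factorial, lossSeq_zero, lossSeq_one, lossSeq_two,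
    lossSeq_three, lossSeq_four, lossSeq_five, lossSeq_six] at h
  have e := exp_two_bounds
  have l2 := Real.log_two_gt_d9
  have l2' := Real.log_two_lt_d9
  have l3 := log_eleven_fourths.1
  have l4 := log_fifteen_fourths.1
  have l5 := log_nineteen_fourths.1
  have l6 := log_twentythree_fourths.1
  -- The number is `2 log 2 - 0.4859`, rounded up.
  have : 0.9003944 ≤ Real.exp (-2) * egf lossSeq 2 := by
    refine le_of_exp_neg_mul ?_
    norm_num at e ⊢
    linarith
  rw [poissonMean]
  linarith

lemma poissonLossDeriv_two_le : poissonLossDeriv 2 ≤ 0.001 := by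
  have h := le_egf_of_affine_le hasExpGrowth_lossSeqDiff 7 2.94 0
    (fun k hk => by simpa using le_lossSeqDiff hk) (t := 2) (by norm_num)
  norm_num [Finset.sum_range_succ, Nat.factorial, lossSeqDiff, lossSeq_zero, lossSeq_one,
    lossSeq_two, lossSeq_three, lossSeq_four, lossSeq_five, lossSeq_six, lossSeq_seven] at h
  have e := exp_two_bounds
  have l2 := Real.log_two_gt_d9
  have l2' := Real.log_two_lt_d9
  have l3 := log_eleven_fourths
  have l4 := log_fifteen_fourths
  have l5 := log_nineteen_fourths
  have l6 := log_twentythree_fourths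
  have l7 := log_twentyseven_fourths
  have : 1.6921472 ≤ Real.exp (-2) * egf lossSeqDiff 2 := by
    refine le_of_exp_neg_mul ?_
    norm_num at e ⊢
    linarith
  rw [poissonLossDeriv, poissonMean]
  linarith

lemma le_poissonLossDeriv_two : -0.003 ≤ poissonLossDeriv 2 := by
  have h := egf_le_of_le_affine hasExpGrowth_lossSeqDiff 7 2.0578 0.14815
    (fun k hk => lossSeqDiff_le hk) (t := 2) (by norm_num)
  norm_num [Finset.sum_range_succ, Nat.factorial, lossSeqDiff, lossSeq_zero, lossSeq_one,
    lossSeq_two, lossSeq_three, lossSeq_four, lossSeq_five, lossSeq_six, lossSeq_seven] at h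
  have e := exp_two_bounds
  have l2 := Real.log_two_gt_d9
  have l2' := Real.log_two_lt_d9
  have l3 := log_eleven_fourths
  have l4 := log_fifteen_fourths
  have l5 := log_nineteen_fourths
  have l6 := log_twentythree_fourths
  have l7 := log_twentyseven_fourths
  have : Real.exp (-2) * egf lossSeqDiff 2 ≤ 1.696147 := by
    refine exp_neg_mul_le_of ?_
    norm_num at e ⊢
    linarith
  rw [poissonLossDeriv, poissonMean]
  linarith

/-! ### The Poisson inequality for small and moderate means. -/

lemma poissonLoss_le_half_of_mem_Icc {t : ℝ} (ht : t ∈ Set.Icc (0.55 : ℝ) 3.65) :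
    poissonLoss t ≤ 1 / 2 := by
  have h := le_taylor_of_deriv2_le (f := poissonLoss) (f' := poissonLossDeriv)
    (f'' := fun t => Real.exp (-t) * egf curvSeq t / t) (a := 0.55) (b := 3.65) (c := 2)
    (M := 0.009) (fun x hx => hasDerivAt_poissonLoss (by linarith [hx.1]))
    (fun x hx => hasDerivAt_poissonLossDeriv (by linarith [hx.1]))
    (fun x hx => by
      have hx0 : 0 < x := by linarith [hx.1]
      rw [div_le_iff₀ hx0]
      refine exp_neg_mul_le_of ((egf_curvSeq_le hx0.le).trans ((curv_poly_le hx.1 hx.2).trans ?_))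
      have he := Real.sum_le_exp_of_nonneg hx0.le 6
      norm_num [Finset.sum_range_succ, Nat.factorial] at he
      gcongr)
    (by norm_num) ht
  have h1 := poissonLoss_two_le
  have h2 := poissonLossDeriv_two_le
  have h3 := le_poissonLossDeriv_two
  obtain ⟨ht1, ht2⟩ := ht
  -- The Taylor bound is at most `0.4859 + 0.003 * 1.45 + 0.0045 * 1.45 ^ 2` on the left and `0.4859
  -- + 0.001 * 1.65 + 0.0045 * 1.65 ^ 2` on the right, both just below 1/2.
  rcases le_total t 2 with h4 | h4
  · nlinarith
  · nlinarith

/-- At `t = 0` equality holds, because `β_0 = 1/2`. For positive `t` the loss is bounded by 1/2 plus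
`t` times a cubic that is nonpositive on this range. -/
lemma poissonLoss_le_half_of_le {t : ℝ} (ht : 0 ≤ t) (ht' : t ≤ 0.55) : poissonLoss t ≤ 1 / 2 := by
  rcases ht.eq_or_lt with rfl | h0
  · have : egf addConst 0 = 1 / 2 := by
      rw [egf, tsum_eq_single 0 (fun k hk => by simp [hk])]
      simp [addConst]
    simp [poissonLoss, poissonMean, this]
  rw [poissonLoss_eq, poissonMean]
  -- From index 3 on `lossSeq` is nonnegative, so only three terms of the series are kept.
  have h := le_egf_of_affine_le hasExpGrowth_lossSeq 3 0 0 (fun k hk => by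
    have hk' : (3 : ℝ) ≤ k := by exact_mod_cast hk
    have : 1 - (1 : ℝ) / 2 ≤ Real.log (k - 1 / 4) := by
      refine le_trans ?_ (Real.one_sub_inv_le_log_of_pos (by linarith))
      have : ((k : ℝ) - 1 / 4)⁻¹ ≤ 1 / 2 := by
        rw [inv_le_comm₀ (by linarith) (by norm_num)]; linarith
      linarith
    rw [lossSeq_of_three_le hk]
    nlinarith) ht
  norm_num [Finset.sum_range_succ, Nat.factorial, lossSeq_zero, lossSeq_one, lossSeq_two] at h
  have l2 := Real.log_two_gt_d9
  have l2' := Real.log_two_lt_d9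
  -- This uses `(1 - t + t²/2) (1 + t + t²/2) = 1 + t⁴/4 ≥ 1`.
  have hE : Real.exp (-t) ≤ 1 - t + t ^ 2 / 2 := by
    have := exp_neg_mul_le_of (x := 1 - t + t ^ 2 / 2) (y := 1) (t := t) (by
      have := Real.quadratic_le_exp_of_nonneg ht
      have h2 : 0 ≤ 1 - t + t ^ 2 / 2 := by nlinarith [sq_nonneg (1 - t)]
      nlinarith [mul_le_mul_of_nonneg_left this h2, sq_nonneg (t ^ 2)])
    linarith
  have hQ : -egf lossSeq t ≤ 1 / 2 + 1.69315 * t - 0.31814 * t ^ 2 := by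
    nlinarith [mul_pos h0 h0]
  have hQ0 : 0 ≤ 1 / 2 + 1.69315 * t - 0.31814 * t ^ 2 := by nlinarith
  have h1 : Real.exp (-t) * -egf lossSeq t
      ≤ (1 - t + t ^ 2 / 2) * (1 / 2 + 1.69315 * t - 0.31814 * t ^ 2) :=
    (mul_le_mul_of_nonneg_left hQ (Real.exp_pos _).le).trans (mul_le_mul_of_nonneg_right hE hQ0)
  -- The tangent to the logarithm at 0.45.
  have hl : Real.log t ≤ -1.7985 + t / 0.45 := by
    have := Real.log_le_sub_one_of_pos (x := t / 0.45) (by positivity)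
    rw [Real.log_div h0.ne' (by norm_num)] at this
    have h45 : Real.log 0.45 = 2 * Real.log 3 - 2 * Real.log 2 - Real.log 5 := by
      rw [show (0.45 : ℝ) = 3 ^ 2 / (2 ^ 2 * 5) by norm_num, Real.log_div (by norm_num)
        (by norm_num), Real.log_mul (by norm_num) (by norm_num), Real.log_pow, Real.log_pow]
      push_cast; ring
    have := Real.log_three_lt_d9
    have := Real.log_five_gt_d9
    linarith
  have h2 : t * Real.log t ≤ t * (-1.7985 + t / 0.45) := by gcongr
  have h3 : t * (-1.7985 + t / 0.45)
      + (1 - t + t ^ 2 / 2) * (1 / 2 + 1.69315 * t - 0.31814 * t ^ 2) ≤ 1 / 2 := by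
    have : t * (-1.7985 + t / 0.45)
      + (1 - t + t ^ 2 / 2) * (1 / 2 + 1.69315 * t - 0.31814 * t ^ 2) - 1 / 2
      = t * (-0.60535 + (20 / 9 - 1.76129) * t + 1.164715 * t ^ 2 - 0.15907 * t ^ 3) := by ring
    have h4 : -0.60535 + (20 / 9 - 1.76129) * t + 1.164715 * t ^ 2 - 0.15907 * t ^ 3 ≤ 0 := by
      have : 0 ≤ t ^ 3 := by positivity
      nlinarith
    nlinarith [mul_nonneg ht (neg_nonneg.2 h4)]
  linarith

/-! ### Binomial means and moments. -/

/-- The mean of `f` under the binomial distribution with parameters `n` and `p`. -/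
noncomputable def binomialMean (n : ℕ) (p : ℝ) (f : ℕ → ℝ) : ℝ :=
  ∑ k ∈ Finset.range (n + 1), (n.choose k : ℝ) * p ^ k * (1 - p) ^ (n - k) * f k

lemma binomialMean_zero (p : ℝ) (f : ℕ → ℝ) : binomialMean 0 p f = f 0 := by
  simp [binomialMean]

lemma binomialMean_succ (n : ℕ) (p : ℝ) (f : ℕ → ℝ) :
    binomialMean (n + 1) p f
      = p * binomialMean n p (fun k => f (k + 1)) + (1 - p) * binomialMean n p f := by
  have h1 : (1 - p) * binomialMean n p f = (1 - p) ^ (n + 1) * f 0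
      + ∑ k ∈ Finset.range (n + 1),
        (n.choose (k + 1) : ℝ) * p ^ (k + 1) * (1 - p) ^ (n - k) * f (k + 1) := by
    rw [Finset.sum_range_succ, binomialMean, Finset.sum_range_succ', mul_add, Finset.mul_sum]
    simp only [Nat.choose_succ_self, Nat.choose_zero_right, Nat.cast_zero, Nat.cast_one, zero_mul,
      pow_zero, Nat.sub_zero]
    have : ∑ k ∈ Finset.range n, (1 - p) * ((n.choose (k + 1) : ℝ) * p ^ (k + 1)
        * (1 - p) ^ (n - (k + 1)) * f (k + 1)) = ∑ k ∈ Finset.range n,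
        (n.choose (k + 1) : ℝ) * p ^ (k + 1) * (1 - p) ^ (n - k) * f (k + 1) := by
      refine Finset.sum_congr rfl fun k hk => ?_
      rw [Finset.mem_range] at hk
      rw [show n - k = n - (k + 1) + 1 by omega, pow_succ]
      ring
    rw [this, pow_succ]
    ring
  rw [h1, binomialMean, Finset.sum_range_succ', binomialMean, Finset.mul_sum]
  simp only [Nat.choose_succ_succ, Nat.choose_zero_right, Nat.cast_one, pow_zero, Nat.sub_zero,
    Nat.add_sub_add_right, Nat.cast_add]
  rw [add_comm ((1 - p) ^ (n + 1) * f 0), ← add_assoc, ← Finset.sum_add_distrib]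
  congr 1
  · exact Finset.sum_congr rfl fun k _ => by ring
  · ring

lemma binomialMean_add (n : ℕ) (p : ℝ) (f g : ℕ → ℝ) :
    binomialMean n p (fun k => f k + g k) = binomialMean n p f + binomialMean n p g := by
  simp only [binomialMean, mul_add, Finset.sum_add_distrib]

lemma binomialMean_const_mul (n : ℕ) (p c : ℝ) (f : ℕ → ℝ) :
    binomialMean n p (fun k => c * f k) = c * binomialMean n p f := by
  simp only [binomialMean, Finset.mul_sum]
  exact Finset.sum_congr rfl fun k _ => by ring

lemma binomialMean_mono {n : ℕ} {p : ℝ} (h0 : 0 ≤ p) (h1 : p ≤ 1) {f g : ℕ → ℝ}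
    (h : ∀ k, f k ≤ g k) : binomialMean n p f ≤ binomialMean n p g :=
  Finset.sum_le_sum fun k _ => by
    have : 0 ≤ 1 - p := by linarith
    have := h k
    gcongr

lemma binomialMean_one (n : ℕ) (p : ℝ) : binomialMean n p (fun _ => 1) = 1 := by
  induction n with
  | zero => rw [binomialMean_zero]
  | succ n ih => rw [binomialMean_succ, ih]; ring

lemma binomialMean_const (n : ℕ) (p c : ℝ) : binomialMean n p (fun _ => c) = c := by
  have := binomialMean_const_mul n p c (fun _ => 1)
  simpa [binomialMean_one] using this

/-- Here and for the second and fourth moments the centre `c` is arbitrary: a success in one further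
trial moves the centre to `c - 1`, so the induction closes. -/
lemma binomialMean_sub (n : ℕ) (p c : ℝ) : binomialMean n p (fun k => k - c) = n * p - c := by
  induction n generalizing c with
  | zero => rw [binomialMean_zero]; simp
  | succ n ih =>
    have h : (fun k : ℕ => ((k + 1 : ℕ) : ℝ) - c) = fun k : ℕ => (k : ℝ) - (c - 1) := by
      ext k; push_cast; ring
    rw [binomialMean_succ, h, ih, ih]
    push_cast
    ring

lemma binomialMean_sub_sq (n : ℕ) (p c : ℝ) :
    binomialMean n p (fun k => (k - c) ^ 2) = n * p * (1 - p) + (n * p - c) ^ 2 := by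
  induction n generalizing c with
  | zero => rw [binomialMean_zero]; simp
  | succ n ih =>
    have h : (fun k : ℕ => (((k + 1 : ℕ) : ℝ) - c) ^ 2) = fun k : ℕ => ((k : ℝ) - (c - 1)) ^ 2 := by
      ext k; push_cast; ring
    rw [binomialMean_succ, h, ih, ih]
    push_cast
    ring

lemma binomialMean_sub_pow_four (n : ℕ) (p c : ℝ) :
    binomialMean n p (fun k => (k - c) ^ 4)
      = 3 * n ^ 2 * p ^ 2 * (1 - p) ^ 2 + n * p * (1 - p) * (1 - 6 * p * (1 - p))
        + 4 * (n * p - c) * (n * p * (1 - p) * (1 - 2 * p))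
        + 6 * (n * p - c) ^ 2 * (n * p * (1 - p)) + (n * p - c) ^ 4 := by
  induction n generalizing c with
  | zero => rw [binomialMean_zero]; simp
  | succ n ih =>
    have h : (fun k : ℕ => (((k + 1 : ℕ) : ℝ) - c) ^ 4) = fun k : ℕ => ((k : ℝ) - (c - 1)) ^ 4 := by
      ext k; push_cast; ring
    rw [binomialMean_succ, h, ih, ih]
    push_cast
    ring

/-- By `(n + 1) C(n, k) = (k + 1) C(n + 1, k + 1)` the left side is the probability of at least one
success in `n + 1` trials. -/
lemma mul_binomialMean_inv_succ_le {n : ℕ} {p : ℝ} (h1 : p ≤ 1) :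
    (n + 1) * p * binomialMean n p (fun k => 1 / ((k : ℝ) + 1)) ≤ 1 := by
  have h := binomialMean_one (n + 1) p
  rw [binomialMean, Finset.sum_range_succ'] at h
  have h2 : (n + 1) * p * binomialMean n p (fun k => 1 / ((k : ℝ) + 1)) =
      ∑ k ∈ Finset.range (n + 1), ((n + 1).choose (k + 1) : ℝ) * p ^ (k + 1)
        * (1 - p) ^ (n + 1 - (k + 1)) * 1 := by
    rw [binomialMean, Finset.mul_sum]
    refine Finset.sum_congr rfl fun k _ => ?_
    have h3 : ((n : ℝ) + 1) * n.choose k = (n + 1).choose (k + 1) * (k + 1) := by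
      exact_mod_cast Nat.add_one_mul_choose_eq n k
    have hk : (k : ℝ) + 1 ≠ 0 := by positivity
    rw [Nat.add_sub_add_right]
    field_simp
    linear_combination (p ^ (k + 1) * (1 - p) ^ (n - k)) * h3
  rw [h2]
  have : 0 ≤ (1 - p) ^ (n + 1) := pow_nonneg (by linarith) _
  simp only [Nat.choose_zero_right, Nat.cast_one, pow_zero, Nat.sub_zero, one_mul, mul_one] at h ⊢
  linarith

/-! ### The binomial loss when the expected count is large. -/

/-- The normalised loss of a letter of probability `p` in a sample of size `n`. -/
noncomputable def binomialLoss (n : ℕ) (p : ℝ) : ℝ :=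
  n * p * Real.log (n * p) - n * p * binomialMean n p (fun k => Real.log (countWeight k))
    + binomialMean n p addConst

lemma binomialLoss_eq {n : ℕ} {p : ℝ} (h : 0 < n * p) :
    binomialLoss n p = binomialMean n p
      (fun k => n * p * -Real.log (countWeight k / (n * p)) + addConst k) := by
  have h1 : (fun k => n * p * -Real.log (countWeight k / (n * p)) + addConst k) =
      fun k => (n * p * Real.log (n * p) + (-(n * p)) * Real.log (countWeight k)) + addConst k := by
    ext k
    rw [Real.log_div (countWeight_pos k).ne' h.ne']
    ring
  rw [h1, binomialMean_add, binomialMean_add, binomialMean_const, binomialMean_const_mul,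
    binomialLoss]
  ring

/-- By `log y ≤ y - 1` the integrand is at least `np - k`, which has mean zero. -/
lemma binomialLoss_nonneg {n : ℕ} {p : ℝ} (h0 : 0 ≤ p) (h1 : p ≤ 1) : 0 ≤ binomialLoss n p := by
  rcases (mul_nonneg n.cast_nonneg h0 : (0 : ℝ) ≤ n * p).eq_or_lt with h | h
  · rw [binomialLoss, ← h]
    have := binomialMean_mono (n := n) h0 h1 (f := fun _ => 0) (fun k => (addConst_pos k).le)
    rw [binomialMean_const] at this
    simpa using this
  · rw [binomialLoss_eq h]
    have h2 := binomialMean_mono (n := n) h0 h1 (f := fun k : ℕ => (-1) * ((k : ℝ) - n * p))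
      (g := fun k => n * p * -Real.log (countWeight k / (n * p)) + addConst k) (fun k => by
        have := Real.log_le_sub_one_of_pos (div_pos (countWeight_pos k) h)
        have h3 : n * p * Real.log (countWeight k / (n * p))
            ≤ n * p * (countWeight k / (n * p) - 1) := by gcongr
        have h4 : n * p * (countWeight k / (n * p) - 1) = countWeight k - n * p := by
          rw [mul_sub, mul_one, mul_div_cancel₀ _ h.ne']
        have h5 : countWeight k = k + addConst k := rfl
        linarith)
    rw [binomialMean_const_mul, binomialMean_sub] at h2
    linarith

/-- The cubic term covers `x ≥ -1/2`. Below that, `16 x ^ 4 ≥ 1` and the quartic term absorbs the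
whole logarithm, which is at most `log (2 L)` in size. -/
lemma neg_log_one_add_le {x L : ℝ} (hL : 1 ≤ L) (hx : 1 / (2 * L) ≤ 1 + x) :
    -Real.log (1 + x) ≤ -x + x ^ 2 / 2 + 2 * |x| ^ 3 + 16 * Real.log (2 * L) * x ^ 4 := by
  have hlog : 0 ≤ Real.log (2 * L) := Real.log_nonneg (by linarith)
  have hlast : 0 ≤ 16 * Real.log (2 * L) * x ^ 4 := by positivity
  rcases le_or_gt 0 x with h0 | h0
  · have h1 := Real.le_log_one_add_of_nonneg h0
    have h2 : x - x ^ 2 / 2 ≤ 2 * x / (x + 2) := by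
      rw [le_div_iff₀ (by linarith)]
      nlinarith [pow_nonneg h0 3]
    have : 0 ≤ |x| ^ 3 := by positivity
    linarith
  rcases le_or_gt (-(1 / 2)) x with h1 | h1
  · have h2 := Real.abs_log_sub_add_sum_range_le (x := -x)
      (by rw [abs_neg, abs_of_neg h0]; linarith) 2
    rw [abs_le, abs_neg, abs_of_neg h0] at h2
    have h3 := h2.1
    norm_num [Finset.sum_range_succ] at h3
    have h4 : (-x) ^ 3 / (1 + x) ≤ 2 * (-x) ^ 3 := by
      rw [div_le_iff₀ (by linarith)]
      have : 0 ≤ (-x) ^ 3 := pow_nonneg (by linarith) 3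
      nlinarith
    rw [abs_of_neg h0]
    linarith
  · have hpos : (0 : ℝ) < 1 / (2 * L) := by positivity
    have h2 : -Real.log (1 + x) ≤ Real.log (2 * L) := by
      rw [← Real.log_inv]
      refine Real.log_le_log (inv_pos.2 (hpos.trans_le hx)) ?_
      rw [inv_le_comm₀ (hpos.trans_le hx) (by positivity), ← one_div]
      exact hx
    have h3 : 1 ≤ 16 * x ^ 4 := by
      have : 1 / 4 ≤ x ^ 2 := by nlinarith
      nlinarith
    have : 0 ≤ |x| ^ 3 := by positivity
    nlinarith [mul_le_mul_of_nonneg_left h3 hlog, sq_nonneg x]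

/-- Here `s ^ 2` plays the role of `np`. The majorant is a polynomial in `k - s ^ 2` of degrees 0,
1, 2 and 4 only, so its mean is explicit, with main term `(k - s ^ 2) ^ 2 / (2 s ^ 2)`. -/
lemma mul_neg_log_countWeight_le {s : ℝ} (hs : 1 ≤ s) (k : ℕ) :
    s ^ 2 * -Real.log (countWeight k / s ^ 2) + addConst k ≤
      -(k - s ^ 2) + (1 / 2 + 1 / s) / s ^ 2 * ((1 + 1 / s) * (k - s ^ 2) ^ 2 + (1 + s))
        + 33 * s / s ^ 6 * (8 * ((k - s ^ 2) ^ 4 + 1)) := by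
  have hs0 : 0 < s := by linarith
  obtain ⟨z, hz⟩ : ∃ z : ℝ, z = k - s ^ 2 := ⟨_, rfl⟩
  obtain ⟨b, hb⟩ : ∃ b, b = addConst k := ⟨_, rfl⟩
  have hb0 : 0 ≤ b := hb ▸ (addConst_pos k).le
  have hb1 : b ≤ 1 := hb ▸ addConst_le_one k
  obtain ⟨x, hx⟩ : ∃ x, x = (z + b) / s ^ 2 := ⟨_, rfl⟩
  have hw : countWeight k / s ^ 2 = 1 + x := by
    rw [hx, hz, hb, countWeight]; field_simp; ring
  have h := neg_log_one_add_le (L := s ^ 2) (x := x) (by nlinarith) (by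
    rw [← hw, div_le_div_iff₀ (by positivity) (by positivity)]
    nlinarith [half_le_countWeight k, sq_nonneg s])
  have hlog : Real.log (2 * s ^ 2) ≤ 2 * s := by
    rw [Real.log_mul (by norm_num) (by positivity), Real.log_pow]
    have := Real.log_le_sub_one_of_pos hs0
    have := Real.log_two_lt_d9
    push_cast
    linarith
  -- The arithmetic-geometric mean inequality trades the absolute third moment for even powers.
  have h3 : 2 * |x| ^ 3 ≤ x ^ 2 / s + s * x ^ 4 := by
    have e : x ^ 2 / s + s * x ^ 4 - 2 * |x| ^ 3 = x ^ 2 / s * (1 - s * |x|) ^ 2 := by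
      rw [← sq_abs x, show x ^ 4 = |x| ^ 4 by rw [← abs_pow, abs_of_nonneg (by positivity)]]
      field_simp
      ring
    have : 0 ≤ x ^ 2 / s * (1 - s * |x|) ^ 2 := by positivity
    linarith
  have h4 : 16 * Real.log (2 * s ^ 2) * x ^ 4 ≤ 16 * (2 * s) * x ^ 4 := by gcongr
  have h5 : -Real.log (1 + x) ≤ -x + (1 / 2 + 1 / s) * x ^ 2 + 33 * s * x ^ 4 := by
    have : (1 / 2 + 1 / s) * x ^ 2 = x ^ 2 / 2 + x ^ 2 / s := by ring
    linarith
  have h6 : x ^ 2 ≤ ((1 + 1 / s) * z ^ 2 + (1 + s)) / s ^ 4 := by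
    rw [hx, div_pow, ← pow_mul]
    gcongr
    have e : (1 + 1 / s) * z ^ 2 + (1 + s) * b ^ 2 - (z + b) ^ 2 = (z - s * b) ^ 2 / s := by
      field_simp; ring
    have : 0 ≤ (z - s * b) ^ 2 / s := by positivity
    have : (1 + s) * b ^ 2 ≤ (1 + s) * 1 := by gcongr; nlinarith
    linarith
  have h7 : x ^ 4 ≤ (8 * (z ^ 4 + 1)) / s ^ 8 := by
    rw [hx, div_pow, ← pow_mul]
    gcongr
    have : b ^ 4 ≤ 1 := pow_le_one₀ hb0 hb1
    nlinarith [sq_nonneg (z - b), sq_nonneg (z ^ 2 - b ^ 2), sq_nonneg (z + b),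
      mul_nonneg (sq_nonneg (z - b)) (sq_nonneg (z + b)), sq_nonneg ((z - b) ^ 2)]
  rw [hw, ← hz, ← hb]
  have h8 : s ^ 2 * -Real.log (1 + x) ≤ s ^ 2 * (-x + (1 / 2 + 1 / s)
      * (((1 + 1 / s) * z ^ 2 + (1 + s)) / s ^ 4) + 33 * s * ((8 * (z ^ 4 + 1)) / s ^ 8)) := by
    refine mul_le_mul_of_nonneg_left (h5.trans ?_) (by positivity)
    gcongr
  have h9 : s ^ 2 * (-x + (1 / 2 + 1 / s)
      * (((1 + 1 / s) * z ^ 2 + (1 + s)) / s ^ 4) + 33 * s * ((8 * (z ^ 4 + 1)) / s ^ 8))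
      = -(z + b) + (1 / 2 + 1 / s) / s ^ 2 * ((1 + 1 / s) * z ^ 2 + (1 + s))
        + 33 * s / s ^ 6 * (8 * (z ^ 4 + 1)) := by
    rw [hx]; field_simp
  linarith

/-- The second central moment `np (1 - p)` produces `(1 - p) / 2`. Every other contribution is `O(1
/ √(np))`, with constants `5/2 + 1056 + 3 + 264 ≤ 1400`. -/
lemma binomialLoss_le_of_one_le {n : ℕ} {p : ℝ} (h0 : 0 ≤ p) (h1 : p ≤ 1) (h : 1 ≤ n * p) :
    binomialLoss n p ≤ (1 - p) / 2 + 1400 / √(n * p) := by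
  obtain ⟨s, hs⟩ : ∃ s, s = √(n * p) := ⟨_, rfl⟩
  have hs2 : s ^ 2 = n * p := by rw [hs, Real.sq_sqrt (by linarith)]
  have hs1 : 1 ≤ s := by rw [hs]; exact Real.one_le_sqrt.2 h
  have hs0 : 0 < s := by linarith
  rw [binomialLoss_eq (by linarith), ← hs, ← hs2]
  refine (binomialMean_mono h0 h1 (fun k => mul_neg_log_countWeight_le hs1 k)).trans ?_
  have e : (fun k : ℕ => -(k - s ^ 2) + (1 / 2 + 1 / s) / s ^ 2
        * ((1 + 1 / s) * (k - s ^ 2) ^ 2 + (1 + s)) + 33 * s / s ^ 6 * (8 * ((k - s ^ 2) ^ 4 + 1)))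
      = fun k : ℕ => (-1) * (k - s ^ 2) + (1 / 2 + 1 / s) / s ^ 2 * (1 + 1 / s) * (k - s ^ 2) ^ 2
        + (33 * s / s ^ 6 * 8) * (k - s ^ 2) ^ 4
        + ((1 / 2 + 1 / s) / s ^ 2 * (1 + s) + 33 * s / s ^ 6 * 8) := by
    ext k; ring
  rw [e, binomialMean_add, binomialMean_add, binomialMean_add, binomialMean_const_mul,
    binomialMean_const_mul, binomialMean_const_mul, binomialMean_const, binomialMean_sub,
    binomialMean_sub_sq, binomialMean_sub_pow_four, ← hs2]
  have e2 : 3 * (n : ℝ) ^ 2 * p ^ 2 * (1 - p) ^ 2 = 3 * s ^ 4 * (1 - p) ^ 2 := by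
    rw [show s ^ 4 = (s ^ 2) ^ 2 by ring, hs2]; ring
  rw [e2]
  have hq : 0 ≤ 1 - p := by linarith
  have hM : 3 * s ^ 4 * (1 - p) ^ 2 + s ^ 2 * (1 - p) * (1 - 6 * p * (1 - p)) ≤ 4 * s ^ 4 := by
    have a1 : (1 - p) ^ 2 ≤ 1 := by nlinarith
    have a2 : 3 * s ^ 4 * (1 - p) ^ 2 ≤ 3 * s ^ 4 * 1 := by gcongr
    have a3 : (1 - p) * (1 - 6 * p * (1 - p)) ≤ 1 := by nlinarith [mul_nonneg h0 (sq_nonneg (1 - p))]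
    have a4 : s ^ 2 * ((1 - p) * (1 - 6 * p * (1 - p))) ≤ s ^ 2 * 1 := by gcongr
    have a5 : s ^ 2 ≤ s ^ 4 := pow_le_pow_right₀ hs1 (by norm_num)
    linarith
  have hr0 : 0 < 1 / s := by positivity
  have hr1 : 1 / s ≤ 1 := by rw [div_le_one hs0]; exact hs1
  obtain ⟨r, hr⟩ : ∃ r, r = 1 / s := ⟨_, rfl⟩
  have b1 : (1 / 2 + 1 / s) / s ^ 2 * (1 + 1 / s) * (s ^ 2 * (1 - p))
      ≤ (1 - p) / 2 + 5 / 2 * (1 / s) := by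
    have : (1 / 2 + 1 / s) / s ^ 2 * (1 + 1 / s) * (s ^ 2 * (1 - p))
        = (1 / 2 + 1 / s) * (1 + 1 / s) * (1 - p) := by
      field_simp
    rw [this, ← hr]
    rw [← hr] at hr0 hr1
    nlinarith [mul_nonneg h0 hr0.le, mul_nonneg hr0.le hr0.le, mul_nonneg hq (sub_nonneg.2 hr1)]
  have b2 : (33 * s / s ^ 6 * 8) * (3 * s ^ 4 * (1 - p) ^ 2
      + s ^ 2 * (1 - p) * (1 - 6 * p * (1 - p))) ≤ 1056 * (1 / s) := by
    calc _ ≤ (33 * s / s ^ 6 * 8) * (4 * s ^ 4) := by gcongr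
      _ = 1056 * (1 / s) := by field_simp; norm_num
  have b3 : (1 / 2 + 1 / s) / s ^ 2 * (1 + s) ≤ 3 * (1 / s) := by
    have : (1 / 2 + 1 / s) / s ^ 2 * (1 + s) = (1 / 2 + 1 / s) * (1 + 1 / s) * (1 / s) := by
      field_simp
      ring
    rw [this, ← hr]
    rw [← hr] at hr0 hr1
    gcongr
    nlinarith
  have b4 : 33 * s / s ^ 6 * 8 ≤ 264 * (1 / s) := by
    have : 33 * s / s ^ 6 * 8 = 264 * (1 / s) * (1 / s ^ 4) := by field_simp; norm_num
    rw [this]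
    have : 1 / s ^ 4 ≤ 1 := by
      rw [div_le_one (by positivity)]; exact one_le_pow₀ hs1
    nlinarith
  have e3 : 1400 / s = 1400 * (1 / s) := by ring
  rw [e3]
  simp only [sub_self, mul_zero, zero_mul, add_zero, ne_eq, OfNat.ofNat_ne_zero, not_false_eq_true,
    zero_pow, zero_add]
  linarith

/-! ### Passage from binomial to Poisson. -/

lemma binomialMean_eq_tsum (n : ℕ) (p : ℝ) (f : ℕ → ℝ) :
    binomialMean n p f = ∑' k, (n.choose k : ℝ) * p ^ k * (1 - p) ^ (n - k) * f k := by
  rw [binomialMean, tsum_eq_sum]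
  intro k hk
  rw [Nat.choose_eq_zero_of_lt (by simpa using hk)]
  simp

/-- The Poisson limit theorem for functions of exponential growth. -/
lemma tendsto_binomialMean {p : ℕ → ℝ} {r : ℝ} (h0 : ∀ n, 0 ≤ p n) (h1 : ∀ n, p n ≤ 1)
    (hr : Tendsto (fun n : ℕ => n * p n) atTop (𝓝 r)) {f : ℕ → ℝ} (hf : HasExpGrowth f) :
    Tendsto (fun n => binomialMean n (p n) f) atTop (𝓝 (poissonMean f r)) := by
  have e : poissonMean f r = ∑' k : ℕ, Real.exp (-r) * r ^ k / k.factorial * f k := by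
    rw [poissonMean, egf, ← tsum_mul_left]
    exact tsum_congr fun k => by ring
  rw [e]
  simp only [binomialMean_eq_tsum]
  -- Eventually `n p ≤ r + 1`, so by `C(n, k) ≤ n ^ k / k!` the binomial weights are dominated by
  -- `(r + 1) ^ k / k!`.
  refine tendsto_tsum_of_dominated_convergence (hf.summable_norm (r + 1)) (fun k =>
    (tendsto_choose_mul_pow_of_tendsto_mul_atTop k hr).mul_const (f k)) ?_
  have hev : ∀ᶠ n : ℕ in atTop, (n : ℝ) * p n < r + 1 := hr.eventually_lt_const (by linarith)
  filter_upwards [hev] with n hn k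
  have hq0 : 0 ≤ 1 - p n := by linarith [h1 n]
  have hnp : 0 ≤ (n : ℝ) * p n := mul_nonneg n.cast_nonneg (h0 n)
  have hp := h0 n
  rw [Real.norm_eq_abs, abs_mul, abs_of_pos (by linarith : 0 < r + 1),
    abs_of_nonneg (by positivity : 0 ≤ (n.choose k : ℝ) * p n ^ k * (1 - p n) ^ (n - k))]
  gcongr
  calc (n.choose k : ℝ) * p n ^ k * (1 - p n) ^ (n - k)
      ≤ (n : ℝ) ^ k / k.factorial * p n ^ k * 1 := by
        gcongr
        · exact Nat.choose_le_pow_div k n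
        · exact pow_le_one₀ hq0 (by linarith)
    _ = (n * p n) ^ k / k.factorial := by rw [mul_pow]; ring
    _ ≤ (r + 1) ^ k / k.factorial := by gcongr

lemma tendsto_binomialLoss {p : ℕ → ℝ} {r : ℝ} (h0 : ∀ n, 0 ≤ p n) (h1 : ∀ n, p n ≤ 1)
    (hr : Tendsto (fun n : ℕ => n * p n) atTop (𝓝 r)) :
    Tendsto (fun n => binomialLoss n (p n)) atTop (𝓝 (poissonLoss r)) := by
  refine (((Real.continuous_mul_log.tendsto r).comp hr).sub (hr.mul ?_)).add ?_
  · exact tendsto_binomialMean h0 h1 hr hasExpGrowth_log_countWeight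
  · exact tendsto_binomialMean h0 h1 hr hasExpGrowth_addConst

lemma exists_tendsto_natCast_mul {t : ℝ} (ht : 0 ≤ t) : ∃ p : ℕ → ℝ, (∀ n, 0 ≤ p n) ∧
    (∀ n, p n ≤ 1) ∧ (∀ᶠ n : ℕ in atTop, n * p n = t) := by
  refine ⟨fun n => min (t / n) 1, fun n => by positivity, fun n => min_le_right _ _, ?_⟩
  have h := tendsto_natCast_atTop_atTop.eventually_ge_atTop (max t 1)
  filter_upwards [h] with n hn
  have hn1 : (1 : ℝ) ≤ n := (le_max_right _ _).trans hn
  have hnt : t ≤ n := (le_max_left _ _).trans hn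
  rw [min_eq_left ((div_le_one (by linarith)).2 hnt)]
  field_simp

/-- This bound and the next are inherited from the binomial loss in the limit. -/
lemma poissonLoss_nonneg {t : ℝ} (ht : 0 ≤ t) : 0 ≤ poissonLoss t := by
  obtain ⟨p, h0, h1, h⟩ := exists_tendsto_natCast_mul ht
  have hr : Tendsto (fun n : ℕ => n * p n) atTop (𝓝 t) :=
    tendsto_const_nhds.congr' (h.mono fun n hn => hn.symm)
  exact ge_of_tendsto' (tendsto_binomialLoss h0 h1 hr)
    (fun n => binomialLoss_nonneg (h0 n) (h1 n))

lemma poissonLoss_le_of_one_le {t : ℝ} (ht : 1 ≤ t) : poissonLoss t ≤ 1 / 2 + 1400 / √t := by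
  obtain ⟨p, h0, h1, h⟩ := exists_tendsto_natCast_mul (by linarith : 0 ≤ t)
  have hr : Tendsto (fun n : ℕ => n * p n) atTop (𝓝 t) :=
    tendsto_const_nhds.congr' (h.mono fun n hn => hn.symm)
  refine le_of_tendsto (tendsto_binomialLoss h0 h1 hr) ?_
  filter_upwards [h] with n hn
  have := binomialLoss_le_of_one_le (n := n) (h0 n) (h1 n) (by rw [hn]; exact ht)
  rw [hn] at this
  linarith [h0 n]

/-! ### The Poisson inequality for large means. -/

lemma tendsto_const_div_sqrt (C : ℝ) : Tendsto (fun t : ℝ => C / √t) atTop (𝓝 0) :=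
  Real.tendsto_sqrt_atTop.const_div_atTop C

/-- A concave function on a half-line that is bounded below does not exceed its upper limit. -/
lemma ConcaveOn.le_of_eventually_le {f : ℝ → ℝ} {c M : ℝ} (hf : ConcaveOn ℝ (Set.Ici c) f)
    (h0 : ∀ x ∈ Set.Ici c, 0 ≤ f x) (hM : ∀ δ > 0, ∀ᶠ x in atTop, f x ≤ M + δ) {x : ℝ}
    (hx : x ∈ Set.Ici c) : f x ≤ M := by
  by_contra! hlt
  obtain ⟨y, hy1, hy2⟩ := ((hM ((f x - M) / 2) (by linarith)).and (eventually_gt_atTop x)).exists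
  have hxy : f y < f x := by linarith
  -- Beyond `y` a concave function lies below its chord through `x` and `y`, and this chord descends
  -- to negative values.
  have hz : ∃ z, y < z ∧ f x + (f y - f x) / (y - x) * (z - x) < 0 := by
    have hs : (f y - f x) / (y - x) < 0 := div_neg_of_neg_of_pos (by linarith) (by linarith)
    have h2 : Tendsto (fun z : ℝ => f x + (f y - f x) / (y - x) * (z - x)) atTop atBot :=
      tendsto_atBot_add_const_left _ _
        ((tendsto_atTop_add_const_right _ (-x) tendsto_id).const_mul_atTop_of_neg hs)
    exact ((eventually_gt_atTop y).and (h2.eventually_lt_atBot 0)).exists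
  obtain ⟨z, hyz, hz⟩ := hz
  have hc : c ≤ x := hx
  have hzc : z ∈ Set.Ici c := by simp only [Set.mem_Ici]; linarith
  have h3 := hf.slope_anti_adjacent hx hzc hy2 hyz
  have h4 := h0 z hzc
  rw [div_le_iff₀ (by linarith)] at h3
  have h5 : (f y - f x) / (y - x) * (z - x)
      = (f y - f x) / (y - x) * (z - y) + (f y - f x) := by
    have : y - x ≠ 0 := by linarith
    field_simp
    ring
  linarith

/-- `egf curvSeq t / t ^ 3` is nonincreasing for `t ≥ 3.65`. -/
lemma egf_curvSeq_div_anti {x y : ℝ} (hx : 3.65 ≤ x) (hxy : x ≤ y) :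
    x ^ 3 * egf curvSeq y ≤ y ^ 3 * egf curvSeq x := by
  have hs := hasExpGrowth_curvSeq.summable
  have h1 : ∀ t, egf curvSeq t = (1 + t * curvSeq 1 + t ^ 2 / 2 * curvSeq 2)
      + ∑' k : ℕ, t ^ (k + 3) / (k + 3).factorial * curvSeq (k + 3) := by
    intro t
    rw [egf, ← (hs t).sum_add_tsum_nat_add 3]
    norm_num [Finset.sum_range_succ, curvSeq_zero, Nat.factorial]
  have hx0 : 0 < x := by linarith
  have hy0 : 0 < y := by linarith
  -- After division by the cube, terms of index at least 3 are nonpositive multiples of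
  -- nondecreasing powers. Indices 0 to 2 are compared separately.
  have h2 : x ^ 3 * ∑' k : ℕ, y ^ (k + 3) / (k + 3).factorial * curvSeq (k + 3)
      ≤ y ^ 3 * ∑' k : ℕ, x ^ (k + 3) / (k + 3).factorial * curvSeq (k + 3) := by
    rw [← tsum_mul_left, ← tsum_mul_left]
    refine Summable.tsum_le_tsum (fun k => ?_)
      (((summable_nat_add_iff 3).2 (hs y)).mul_left _)
      (((summable_nat_add_iff 3).2 (hs x)).mul_left _)
    have hneg : curvSeq (k + 3) ≤ 0 := by
      rcases k with _ | k
      · linarith [curvSeq_three_bounds.2]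
      · exact curvSeq_nonpos (by omega)
    have e1 : x ^ 3 * (y ^ (k + 3) / (k + 3).factorial * curvSeq (k + 3))
        = (x ^ 3 * y ^ 3 / (k + 3).factorial) * (y ^ k * curvSeq (k + 3)) := by
      rw [pow_add]; ring
    have e2 : y ^ 3 * (x ^ (k + 3) / (k + 3).factorial * curvSeq (k + 3))
        = (x ^ 3 * y ^ 3 / (k + 3).factorial) * (x ^ k * curvSeq (k + 3)) := by
      rw [pow_add]; ring
    rw [e1, e2]
    refine mul_le_mul_of_nonneg_left ?_ (by positivity)
    exact mul_le_mul_of_nonpos_right (pow_le_pow_left₀ hx0.le hxy k) hneg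
  have h3 : x ^ 3 * (1 + y * curvSeq 1 + y ^ 2 / 2 * curvSeq 2)
      ≤ y ^ 3 * (1 + x * curvSeq 1 + x ^ 2 / 2 * curvSeq 2) := by
    have b1 := curvSeq_one_bounds.1
    have b2 := curvSeq_two_bounds.1
    have e : y ^ 3 * (1 + x * curvSeq 1 + x ^ 2 / 2 * curvSeq 2)
        - x ^ 3 * (1 + y * curvSeq 1 + y ^ 2 / 2 * curvSeq 2)
        = (y - x) * ((x ^ 2 + x * y + y ^ 2) + x * y * (x + y) * curvSeq 1
          + x ^ 2 * y ^ 2 / 2 * curvSeq 2) := by ring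
    have h4 : 0 ≤ (x ^ 2 + x * y + y ^ 2) + x * y * (x + y) * (-2.5226)
          + x ^ 2 * y ^ 2 / 2 * 2.3618 := by
      -- Expressed in the nonnegative increments `u` and `v`, the polynomial is visibly nonnegative.
      obtain ⟨u, rfl⟩ : ∃ u, x = 3.65 + u := ⟨x - 3.65, by ring⟩
      obtain ⟨v, rfl⟩ : ∃ v, y = 3.65 + u + v := ⟨y - (3.65 + u), by ring⟩
      have hu : 0 ≤ u := by linarith
      have hv : 0 ≤ v := by linarith
      ring_nf
      positivity
    have h5 : x * y * (x + y) * (-2.5226) ≤ x * y * (x + y) * curvSeq 1 := by gcongr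
    have h6 : x ^ 2 * y ^ 2 / 2 * 2.3618 ≤ x ^ 2 * y ^ 2 / 2 * curvSeq 2 := by gcongr
    have : 0 ≤ (y - x) * ((x ^ 2 + x * y + y ^ 2) + x * y * (x + y) * curvSeq 1
          + x ^ 2 * y ^ 2 / 2 * curvSeq 2) := mul_nonneg (by linarith) (by linarith)
    linarith
  rw [h1, h1]
  linarith

lemma egf_curvSeq_nonpos_of_le {x y : ℝ} (hx : 3.65 ≤ x) (hxy : x ≤ y) (h : egf curvSeq x ≤ 0) :
    egf curvSeq y ≤ 0 := by
  have h1 := egf_curvSeq_div_anti hx hxy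
  have h2 : y ^ 3 * egf curvSeq x ≤ 0 :=
    mul_nonpos_of_nonneg_of_nonpos (pow_nonneg (by linarith) 3) h
  by_contra! h3
  have : 0 < x ^ 3 * egf curvSeq y := mul_pos (pow_pos (by linarith) 3) h3
  linarith

lemma egf_curvSeq_nonneg_of_le {x y : ℝ} (hx : 3.65 ≤ x) (hxy : x ≤ y) (h : 0 ≤ egf curvSeq y) :
    0 ≤ egf curvSeq x := by
  have h1 := egf_curvSeq_div_anti hx hxy
  have h2 : 0 ≤ x ^ 3 * egf curvSeq y := mul_nonneg (pow_nonneg (by linarith) 3) h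
  by_contra! h3
  have : y ^ 3 * egf curvSeq x < 0 := mul_neg_of_pos_of_neg (pow_pos (by linarith) 3) h3
  linarith

lemma poissonLoss_le_half_of_egf_curvSeq_nonpos {c : ℝ} (hc : 3.65 ≤ c) (h : egf curvSeq c ≤ 0)
    {t : ℝ} (ht : c ≤ t) : poissonLoss t ≤ 1 / 2 := by
  have hconc : ConcaveOn ℝ (Set.Ici c) poissonLoss := by
    refine concaveOn_of_hasDerivWithinAt2_nonpos (f' := poissonLossDeriv)
      (f'' := fun t => Real.exp (-t) * egf curvSeq t / t)
      (convex_Ici c) continuous_poissonLoss.continuousOn ?_ ?_ ?_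
    all_goals
      intro x hx
      have hx1 : c ≤ x := interior_subset hx
      have hx0 : 0 < x := by linarith
    · exact (hasDerivAt_poissonLoss hx0).hasDerivWithinAt
    · exact (hasDerivAt_poissonLossDeriv hx0).hasDerivWithinAt
    · have := egf_curvSeq_nonpos_of_le hc hx1 h
      exact div_nonpos_of_nonpos_of_nonneg
        (mul_nonpos_of_nonneg_of_nonpos (Real.exp_pos _).le this) hx0.le
  refine ConcaveOn.le_of_eventually_le hconc (fun x hx => poissonLoss_nonneg ?_) ?_ ht
  · have : c ≤ x := hx
    linarith
  · intro δ hδ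
    filter_upwards [(tendsto_const_div_sqrt 1400).eventually_lt_const hδ, eventually_ge_atTop 1]
      with x hx hx1
    linarith [poissonLoss_le_of_one_le hx1]

/-- The curvature changes sign at most once past 3.65, from positive to negative, at some `c`. On
the convex stretch up to `c` the maximum is at an endpoint: 3.65 belongs to the middle range and `c`
to the concave one. -/
lemma poissonLoss_le_half_of_ge {t : ℝ} (ht : 3.65 ≤ t) : poissonLoss t ≤ 1 / 2 := by
  rcases le_or_gt (egf curvSeq 3.65) 0 with h | h
  · exact poissonLoss_le_half_of_egf_curvSeq_nonpos le_rfl h ht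
  have h8 : egf curvSeq 8 ≤ 0 := (egf_curvSeq_le (by norm_num)).trans (by norm_num)
  obtain ⟨c, hc, hc0⟩ := intermediate_value_Icc' (by norm_num : (3.65 : ℝ) ≤ 8)
    (continuous_egf hasExpGrowth_curvSeq).continuousOn ⟨h8, h.le⟩
  rcases le_total c t with hct | htc
  · exact poissonLoss_le_half_of_egf_curvSeq_nonpos hc.1 hc0.le hct
  have hconv : ConvexOn ℝ (Set.Icc 3.65 c) poissonLoss := by
    refine convexOn_of_hasDerivWithinAt2_nonneg (f' := poissonLossDeriv)
      (f'' := fun t => Real.exp (-t) * egf curvSeq t / t)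
      (convex_Icc _ c) continuous_poissonLoss.continuousOn ?_ ?_ ?_
    all_goals
      intro x hx
      have hx1 : x ∈ Set.Icc 3.65 c := interior_subset hx
      have hx0 : 0 < x := by linarith [hx1.1]
    · exact (hasDerivAt_poissonLoss hx0).hasDerivWithinAt
    · exact (hasDerivAt_poissonLossDeriv hx0).hasDerivWithinAt
    · have := egf_curvSeq_nonneg_of_le hx1.1 hx1.2 hc0.ge
      positivity
  refine (hconv.le_max_of_mem_Icc ⟨le_rfl, hc.1⟩ ⟨hc.1, le_rfl⟩ ⟨ht, htc⟩).trans (max_le ?_ ?_)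
  · exact poissonLoss_le_half_of_mem_Icc (by norm_num)
  · exact poissonLoss_le_half_of_egf_curvSeq_nonpos hc.1 hc0.le le_rfl

/-- The Braess-Sauer bound for Poisson distributed counts. -/
theorem poissonLoss_le_half {t : ℝ} (ht : 0 ≤ t) : poissonLoss t ≤ 1 / 2 := by
  rcases le_total t 0.55 with h | h
  · exact poissonLoss_le_half_of_le ht h
  rcases le_total t 3.65 with h' | h'
  · exact poissonLoss_le_half_of_mem_Icc ⟨h, h'⟩
  · exact poissonLoss_le_half_of_ge h'

/-- The Braess-Sauer bound for binomial counts, uniformly in the success probability. -/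
theorem eventually_binomialLoss_le {δ : ℝ} (hδ : 0 < δ) :
    ∀ᶠ n : ℕ in atTop, ∀ p : ℝ, 0 ≤ p → p ≤ 1 → binomialLoss n p ≤ (1 - p) / 2 + δ := by
  by_contra hcon
  rw [not_eventually] at hcon
  obtain ⟨φ, hφ, hv⟩ := extraction_of_frequently_atTop hcon
  push Not at hv
  choose q hq0 hq1 hq using hv
  -- The explicit error excludes counterexamples with expected count above `K`, so the expected
  -- counts stay in a compact interval.
  obtain ⟨K, hK1, hK⟩ := ((eventually_ge_atTop (1 : ℝ)).and
    ((tendsto_const_div_sqrt 1400).eventually_lt_const hδ)).exists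
  have hbd : ∀ m, (φ m : ℝ) * q m ∈ Set.Icc 0 K := fun m => by
    refine ⟨mul_nonneg (Nat.cast_nonneg _) (hq0 m), ?_⟩
    by_contra! hgt
    have h1 := binomialLoss_le_of_one_le (hq0 m) (hq1 m) (hK1.trans hgt.le)
    have h2 : 1400 / √(φ m * q m) ≤ 1400 / √K := by
      have : 0 < √K := Real.sqrt_pos.2 (by linarith [hK1])
      gcongr
    linarith [hq m]
  obtain ⟨r, hr, ψ, hψ, hlim⟩ := isCompact_Icc.tendsto_subseq hbd
  have hr0 : 0 ≤ r := hr.1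
  obtain ⟨p₀, hp0, hp1, hp⟩ := exists_tendsto_natCast_mul hr0
  have hinj : Function.Injective (φ ∘ ψ) := (hφ.comp hψ).injective
  classical
  -- The Poisson limit needs a probability for every `n`. The gaps of the subsequence are filled
  -- with `p₀`, for which `n p₀ n` is eventually equal to the limit `r`.
  set p : ℕ → ℝ := Function.extend (φ ∘ ψ) (q ∘ ψ) p₀
  have hpφ : ∀ m, p (φ (ψ m)) = q (ψ m) := fun m => hinj.extend_apply (q ∘ ψ) p₀ m
  have hcases : ∀ n, (∃ m, φ (ψ m) = n) ∨ p n = p₀ n := fun n => by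
    by_cases h : ∃ m, (φ ∘ ψ) m = n
    · exact Or.inl h
    · exact Or.inr (Function.extend_apply' _ _ _ h)
  have h0 : ∀ n, 0 ≤ p n := fun n => by
    rcases hcases n with ⟨m, rfl⟩ | h
    · rw [hpφ]; exact hq0 _
    · rw [h]; exact hp0 n
  have h1 : ∀ n, p n ≤ 1 := fun n => by
    rcases hcases n with ⟨m, rfl⟩ | h
    · rw [hpφ]; exact hq1 _
    · rw [h]; exact hp1 n
  have hlimp : Tendsto (fun n : ℕ => n * p n) atTop (𝓝 r) := by
    rw [tendsto_def]
    intro s hs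
    obtain ⟨M, hM⟩ := eventually_atTop.1 (hlim.eventually hs)
    filter_upwards [hp, eventually_ge_atTop (φ (ψ M))] with n hn hnM
    rw [Set.mem_preimage]
    rcases hcases n with ⟨m, rfl⟩ | h
    · rw [hpφ]
      exact hM m ((hφ.comp hψ).le_iff_le.1 hnM)
    · rw [h, hn]
      exact mem_of_mem_nhds hs
  have hpz := tendsto_zero_of_tendsto_mul_atTop hlimp
  have hT : Tendsto (fun n => binomialLoss n (p n) - (1 - p n) / 2) atTop
      (𝓝 (poissonLoss r - (1 - 0) / 2)) :=
    (tendsto_binomialLoss h0 h1 hlimp).sub ((tendsto_const_nhds.sub hpz).div_const 2)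
  have hle := poissonLoss_le_half hr0
  have hev := hT.eventually_lt_const (show poissonLoss r - (1 - 0) / 2 < δ by linarith)
  obtain ⟨m, hm⟩ := ((hφ.comp hψ).tendsto_atTop.eventually hev).exists
  simp only [Function.comp_apply, hpφ] at hm
  linarith [hq (ψ m)]

/-! ### Divergence and risk on a finite alphabet. -/

lemma optWeight_eq {V : Type*} [DecidableEq V] {n : ℕ} (x : Fin n → V) (i : V) :
    optWeight x i = countWeight (letterCount x i) := rfl

lemma sum_optWeight_le {V : Type*} [DecidableEq V] (A : Finset V) {n : ℕ} (x : Fin n → V) :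
    ∑ i ∈ A, optWeight x i ≤ n + ∑ i ∈ A, addConst (letterCount x i) := by
  have h : ∑ i ∈ A, letterCount x i ≤ n := by
    simp only [letterCount]
    rw [Finset.sum_card_fiberwise_eq_card_filter]
    exact (Finset.card_filter_le _ _).trans (by simp)
  have h' : (∑ i ∈ A, (letterCount x i : ℝ)) ≤ n := by exact_mod_cast h
  simp only [optWeight, Finset.sum_add_distrib]
  linarith

lemma optEstimator_singleton {V : Type*} [DecidableEq V] [MeasurableSpace V]
    [MeasurableSingletonClass V] {A : Finset V} {n : ℕ} (x : Fin n → V) {i : V} (hi : i ∈ A) :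
    (optEstimator A x).real {i} = optWeight x i / ∑ j ∈ A, optWeight x j := by
  have h : (optEstimator A x) {i} = ENNReal.ofReal (optWeight x i / ∑ j ∈ A, optWeight x j) := by
    simp only [optEstimator, Measure.coe_finsetSum, Finset.sum_apply, Measure.smul_apply,
      smul_eq_mul, Measure.dirac_apply, Set.indicator_apply, Set.mem_singleton_iff, Pi.one_apply,
      mul_ite, mul_one, mul_zero]
    rw [Finset.sum_ite_eq' A i, if_pos hi]
  rw [measureReal_def, h, ENNReal.toReal_ofReal]
  exact div_nonneg (optWeight_pos x i).le (Finset.sum_nonneg fun j _ => (optWeight_pos x j).le)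

lemma absolutelyContinuous_of_singleton {V : Type*} [Countable V] [MeasurableSpace V]
    {μ ν : Measure V} (h : ∀ i, ν {i} = 0 → μ {i} = 0) : μ ≪ ν := by
  intro s hs
  rw [← Set.biUnion_of_singleton s, measure_biUnion_null_iff s.to_countable]
  exact fun i hi => h i (measure_mono_null (Set.singleton_subset_iff.2 hi) hs)

section FiniteAlphabet

variable {V : Type*} [Fintype V] [MeasurableSpace V] [MeasurableSingletonClass V]

lemma klDiv_ne_top_of_ac {μ ν : Measure V} [IsFiniteMeasure μ] (h : μ ≪ ν) : klDiv μ ν ≠ ∞ :=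
  klDiv_ne_top h .of_finite

/-- The Kullback-Leibler divergence on a finite alphabet. -/
lemma toReal_klDiv_eq_sum {μ ν : Measure V} [IsProbabilityMeasure μ] [IsProbabilityMeasure ν]
    (h : μ ≪ ν) : (klDiv μ ν).toReal
      = ∑ i, μ.real {i} * (Real.log (μ.real {i}) - Real.log (ν.real {i})) := by
  rw [toReal_klDiv_of_measure_eq h (by simp), integral_fintype .of_finite]
  refine Finset.sum_congr rfl fun i _ => ?_
  rw [smul_eq_mul]
  by_cases hi : μ {i} = 0
  · simp [measureReal_def, hi]
  have hν : ν {i} ≠ 0 := fun h0 => hi (h h0)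
  have h1 : μ {i} = μ.rnDeriv ν i * ν {i} := by
    conv_lhs => rw [← Measure.withDensity_rnDeriv_eq μ ν h]
    rw [withDensity_apply _ (measurableSet_singleton i), lintegral_singleton]
  have h2 : μ.real {i} = (μ.rnDeriv ν i).toReal * ν.real {i} := by
    rw [measureReal_def, measureReal_def, h1, ENNReal.toReal_mul]
  have hμr : μ.real {i} ≠ 0 := by
    rw [measureReal_def]; exact ENNReal.toReal_ne_zero.2 ⟨hi, measure_ne_top _ _⟩
  have hνr : ν.real {i} ≠ 0 := by
    rw [measureReal_def]; exact ENNReal.toReal_ne_zero.2 ⟨hν, measure_ne_top _ _⟩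
  rw [llr, ← Real.log_div hμr hνr, h2, mul_div_cancel_right₀ _ hνr]

lemma sum_measureReal_singleton_eq_one {μ : Measure V} [IsProbabilityMeasure μ] {A : Finset V}
    (h : ∀ i, i ∉ A → μ {i} = 0) : ∑ i ∈ A, μ.real {i} = 1 := by
  rw [Finset.sum_subset A.subset_univ (fun i _ hi => by simp [measureReal_def, h i hi])]
  simp

lemma nonempty_of_support {μ : Measure V} [IsProbabilityMeasure μ] {A : Finset V}
    (h : ∀ i, i ∉ A → μ {i} = 0) : A.Nonempty := by
  rw [Finset.nonempty_iff_ne_empty]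
  rintro rfl
  simpa using sum_measureReal_singleton_eq_one h

variable {Ω : Type*} [MeasurableSpace Ω] {P : Measure Ω} {n : ℕ} {X : Fin n → Ω → V}

lemma toReal_lintegral_sample (hX : ∀ j, AEMeasurable (X j) P) {K : (Fin n → V) → ℝ≥0∞}
    (hK : ∀ x, K x ≠ ∞) :
    (∫⁻ ω, K (fun j => X j ω) ∂P).toReal = ∫ ω, (K (fun j => X j ω)).toReal ∂P := by
  have hm : AEMeasurable (fun ω j => X j ω) P := aemeasurable_pi_lambda _ hX
  have hd : Measurable K := Measurable.of_discrete
  exact (integral_toReal (hd.comp_aemeasurable hm) (.of_forall fun ω => (hK _).lt_top)).symm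

variable [IsProbabilityMeasure P]

lemma integrable_sample (hX : ∀ j, AEMeasurable (X j) P) (F : (Fin n → V) → ℝ) :
    Integrable (fun ω => F (fun j => X j ω)) P := by
  have hm : AEMeasurable (fun ω j => X j ω) P := aemeasurable_pi_lambda _ hX
  have : IsFiniteMeasure (P.map (fun ω j => X j ω)) := inferInstance
  exact (Integrable.of_finite (μ := P.map (fun ω j => X j ω)) (f := F)).comp_aemeasurable hm

lemma lintegral_sample_ne_top (hX : ∀ j, AEMeasurable (X j) P) {K : (Fin n → V) → ℝ≥0∞}
    (hK : ∀ x, K x ≠ ∞) : ∫⁻ ω, K (fun j => X j ω) ∂P ≠ ∞ := by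
  have h := (integrable_sample hX (fun x => (K x).toReal)).lintegral_lt_top.ne
  simpa only [ENNReal.ofReal_toReal (hK _)] using h

variable [DecidableEq V]

lemma absolutelyContinuous_optEstimator {μ : Measure V} {A : Finset V}
    (h : ∀ i, i ∉ A → μ {i} = 0) {n : ℕ} (x : Fin n → V) : μ ≪ optEstimator A x := by
  refine absolutelyContinuous_of_singleton fun i hi => ?_
  by_contra hne
  have hA : i ∈ A := by_contra fun hA => hne (h i hA)
  have h1 := optEstimator_singleton x hA
  rw [measureReal_def, hi] at h1
  have : 0 < ∑ j ∈ A, optWeight x j := Finset.sum_pos (fun j _ => optWeight_pos x j) ⟨i, hA⟩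
  have := div_pos (optWeight_pos x i) this
  simp at h1
  linarith

lemma toReal_klDiv_optEstimator {μ : Measure V} [IsProbabilityMeasure μ] {A : Finset V}
    (h : ∀ i, i ∉ A → μ {i} = 0) {n : ℕ} (x : Fin n → V) :
    (klDiv μ (optEstimator A x)).toReal = ∑ i ∈ A, μ.real {i} *
      (Real.log (μ.real {i}) + Real.log (∑ j ∈ A, optWeight x j) - Real.log (optWeight x i)) := by
  have hA := nonempty_of_support h
  have := isProbabilityMeasure_optEstimator hA x
  rw [toReal_klDiv_eq_sum (absolutelyContinuous_optEstimator h x),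
    ← Finset.sum_subset A.subset_univ (fun i _ hi => by simp [measureReal_def, h i hi])]
  refine Finset.sum_congr rfl fun i hi => ?_
  have hS : 0 < ∑ j ∈ A, optWeight x j := Finset.sum_pos (fun j _ => optWeight_pos x j) hA
  rw [optEstimator_singleton x hi, Real.log_div (optWeight_pos x i).ne' hS.ne']
  ring

/-- The number of occurrences of a letter in an i.i.d. sample is binomial. -/
lemma integral_letterCount {π : Measure V} [IsProbabilityMeasure π] (hI : iIndepFun X P)
    (hX : ∀ j, HasLaw (X j) π P) (i : V) (f : ℕ → ℝ) :
    ∫ ω, f (letterCount (fun j => X j ω) i) ∂P = binomialMean n (π.real {i}) f := by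
  -- `E s` is the event that the letter occurs exactly at the positions in `s`. These events
  -- partition the space, and independence gives their probabilities.
  let E : Finset (Fin n) → Set Ω := fun s =>
    ⋂ j ∈ (Finset.univ : Finset (Fin n)), X j ⁻¹' (if j ∈ s then {i} else {i}ᶜ)
  have hmem : ∀ s ω, ω ∈ E s ↔ Finset.univ.filter (fun j => X j ω = i) = s := fun s ω => by
    simp only [E, Set.mem_iInter, Finset.mem_univ, forall_true_left, Set.mem_preimage,
      Finset.ext_iff, Finset.mem_filter, true_and]
    refine forall_congr' fun j => ?_
    by_cases hj : j ∈ s <;> simp [hj]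
  have hset : ∀ (s : Finset (Fin n)) (j : Fin n),
      MeasurableSet (if j ∈ s then {i} else {i}ᶜ : Set V) := fun s j => .of_discrete
  have hE : ∀ s, P.real (E s) = π.real {i} ^ s.card * (1 - π.real {i}) ^ (n - s.card) := by
    intro s
    rw [measureReal_def, hI.measure_inter_preimage_eq_mul Finset.univ (fun j _ => hset s j),
      ENNReal.toReal_prod]
    have hj : ∀ j, (P (X j ⁻¹' (if j ∈ s then {i} else {i}ᶜ))).toReal
        = if j ∈ s then π.real {i} else 1 - π.real {i} := fun j => by
      rw [← Measure.map_apply_of_aemeasurable (hX j).aemeasurable (hset s j), (hX j).map_eq]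
      split_ifs
      · rfl
      · rw [← measureReal_def, probReal_compl_eq_one_sub (measurableSet_singleton i)]
    simp only [hj]
    rw [Finset.prod_ite]
    simp only [Finset.prod_const]
    congr 2
    · simp
    · rw [← Finset.compl_filter, Finset.card_compl]; simp
  have hEm : ∀ s, NullMeasurableSet (E s) P := fun s =>
    Finset.nullMeasurableSet_biInter _ fun j _ =>
      (hX j).aemeasurable.nullMeasurable (hset s j)
  have hf : ∀ ω, f (letterCount (fun j => X j ω) i)
      = ∑ s ∈ (Finset.univ : Finset (Fin n)).powerset, (E s).indicator (fun _ => f s.card) ω := by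
    intro ω
    rw [Finset.sum_eq_single (Finset.univ.filter (fun j => X j ω = i))]
    · rw [Set.indicator_of_mem ((hmem _ _).2 rfl)]
      rfl
    · intro s _ hs
      exact Set.indicator_of_notMem (fun h => hs ((hmem _ _).1 h).symm) _
    · simp
  simp only [hf]
  rw [integral_finsetSum _ (fun s _ => (integrable_const _).indicator₀ (hEm s))]
  have hs : ∀ s, ∫ ω, (E s).indicator (fun _ => f s.card) ω ∂P
      = π.real {i} ^ s.card * (1 - π.real {i}) ^ (n - s.card) * f s.card := fun s => by
    rw [integral_indicator₀ (hEm s), setIntegral_const, hE, smul_eq_mul]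
  simp only [hs]
  rw [Finset.sum_powerset_apply_card
    (fun k => π.real {i} ^ k * (1 - π.real {i}) ^ (n - k) * f k), binomialMean]
  simp only [Finset.card_univ, Fintype.card_fin, nsmul_eq_mul]
  exact Finset.sum_congr rfl fun k _ => by ring

/-- The risk of the estimator is at most the sum of the losses of the letters. -/
lemma integral_klDiv_optEstimator_le (hn : 1 ≤ n) {π : Measure V} [IsProbabilityMeasure π]
    {A : Finset V} (hA : ∀ i, i ∉ A → π {i} = 0) (hI : iIndepFun X P)
    (hX : ∀ j, HasLaw (X j) π P) :
    n * ∫ ω, (klDiv π (optEstimator A (fun j => X j ω))).toReal ∂P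
      ≤ ∑ i ∈ A, binomialLoss n (π.real {i}) := by
  have hn0 : (0 : ℝ) < n := by exact_mod_cast hn
  have hAE : ∀ j, AEMeasurable (X j) P := fun j => (hX j).aemeasurable
  have hsum := sum_measureReal_singleton_eq_one hA
  let G : V → ℕ → ℝ := fun i k => n * π.real {i} * Real.log (n * π.real {i})
    - n * π.real {i} * Real.log (countWeight k) + addConst k
  have hpt : ∀ x : Fin n → V, n * (klDiv π (optEstimator A x)).toReal
      ≤ ∑ i ∈ A, G i (letterCount x i) := fun x => by
    have hS : 0 < ∑ j ∈ A, optWeight x j :=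
      Finset.sum_pos (fun j _ => optWeight_pos x j) (nonempty_of_support hA)
    -- The tangent to the logarithm at `n` turns the normaliser, which couples all letters, into a
    -- sum over letters. This is the origin of the summand `addConst` in the loss.
    have hlog : n * Real.log (∑ j ∈ A, optWeight x j)
        ≤ n * Real.log n + ∑ i ∈ A, addConst (letterCount x i) := by
      have h1 := Real.log_le_sub_one_of_pos (div_pos hS hn0)
      rw [Real.log_div hS.ne' hn0.ne', div_sub_one hn0.ne', le_div_iff₀ hn0] at h1
      linarith [sum_optWeight_le A x]
    have e : n * (klDiv π (optEstimator A x)).toReal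
        = ∑ i ∈ A, n * π.real {i} * (Real.log (π.real {i}) - Real.log (optWeight x i))
          + n * Real.log (∑ j ∈ A, optWeight x j) := by
      have h1 : Real.log (∑ j ∈ A, optWeight x j)
          = ∑ i ∈ A, π.real {i} * Real.log (∑ j ∈ A, optWeight x j) := by
        rw [← Finset.sum_mul, hsum, one_mul]
      rw [toReal_klDiv_optEstimator hA, h1, Finset.mul_sum, Finset.mul_sum,
        ← Finset.sum_add_distrib, ← h1]
      exact Finset.sum_congr rfl fun i _ => by ring
    have e2 : n * Real.log n = ∑ i ∈ A, n * π.real {i} * Real.log n := by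
      rw [← Finset.sum_mul, ← Finset.mul_sum, hsum, mul_one]
    rw [e]
    refine (add_le_add_right hlog _).trans_eq ?_
    rw [e2, ← Finset.sum_add_distrib, ← Finset.sum_add_distrib]
    refine Finset.sum_congr rfl fun i _ => ?_
    simp only [G, optWeight_eq]
    rcases eq_or_ne (π.real {i}) 0 with h0 | h0
    · simp [h0]
    · rw [Real.log_mul hn0.ne' h0]
      ring
  rw [← integral_const_mul]
  refine (integral_mono (integrable_sample hAE (fun x => n * (klDiv π (optEstimator A x)).toReal))
    (integrable_sample hAE (fun x => ∑ i ∈ A, G i (letterCount x i)))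
    (fun ω => hpt (fun j => X j ω))).trans_eq ?_
  rw [integral_finsetSum _ (fun i _ => integrable_sample hAE (fun x => G i (letterCount x i)))]
  refine Finset.sum_congr rfl fun i _ => ?_
  rw [integral_letterCount hI hX i (G i)]
  have hG : G i = fun k => (n * π.real {i} * Real.log (n * π.real {i})
      + (-(n * π.real {i})) * Real.log (countWeight k)) + addConst k := by
    ext k; simp only [G]; ring
  rw [hG, binomialMean_add, binomialMean_add, binomialMean_const, binomialMean_const_mul,
    binomialLoss]
  ring

/-- The factor 2 comes from `β ≥ 1/2` and is the source of the `log 2` in the risk bound. -/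
lemma inv_countWeight_le (k : ℕ) : 1 / countWeight k ≤ 2 * (1 / ((k : ℝ) + 1)) := by
  have h1 := half_le_addConst k
  have hk : (0 : ℝ) ≤ k := k.cast_nonneg
  rw [mul_one_div, div_le_div_iff₀ (countWeight_pos k) (by positivity)]
  unfold countWeight
  linarith

/-- The risk with respect to `π` of the estimator computed from samples of `ρ`. -/
lemma integral_klDiv_optEstimator_le_klDiv_add (hn : 1 ≤ n) {π ρ : Measure V}
    [IsProbabilityMeasure π] [IsProbabilityMeasure ρ] {A : Finset V}
    (hA : ∀ i, i ∉ A → ρ {i} = 0) (hπ : π ≪ ρ) (hI : iIndepFun X P)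
    (hX : ∀ j, HasLaw (X j) ρ P) :
    ∫ ω, (klDiv π (optEstimator A (fun j => X j ω))).toReal ∂P
      ≤ (klDiv π ρ).toReal + Real.log (1 + (A.card : ℝ) / n) + Real.log 2 := by
  have hn0 : (0 : ℝ) < n := by exact_mod_cast hn
  have hAE : ∀ j, AEMeasurable (X j) P := fun j => (hX j).aemeasurable
  have hA' : ∀ i, i ∉ A → π {i} = 0 := fun i hi => hπ (hA i hi)
  have hsum := sum_measureReal_singleton_eq_one hA'
  -- `c` bounds the mean of `ρ S / w` for each letter. Using the tangent to the logarithm at `c`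
  -- does the work of Jensen's inequality.
  obtain ⟨c, hc⟩ : ∃ c : ℝ, c = 2 * (n + A.card) / (n + 1) := ⟨_, rfl⟩
  have hc0 : 0 < c := by rw [hc]; positivity
  have hlogc : Real.log c ≤ Real.log (1 + (A.card : ℝ) / n) + Real.log 2 := by
    rw [← Real.log_mul (by positivity) (by norm_num)]
    refine Real.log_le_log hc0 ?_
    have e : (1 + (A.card : ℝ) / n) * 2 = 2 * (n + A.card) / n := by field_simp
    rw [hc, e]
    gcongr
    linarith
  have hKL : (klDiv π ρ).toReal
      = ∑ i ∈ A, π.real {i} * (Real.log (π.real {i}) - Real.log (ρ.real {i})) := by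
    rw [toReal_klDiv_eq_sum hπ]
    exact (Finset.sum_subset A.subset_univ
      (fun i _ hi => by simp [measureReal_def, hA' i hi])).symm
  let G : V → ℕ → ℝ := fun i k => π.real {i} * (Real.log (π.real {i}) - Real.log (ρ.real {i})
    + (Real.log c - 1)) + π.real {i} * ((n + 1) * ρ.real {i}) * (1 / ((k : ℝ) + 1))
  have hpt : ∀ x : Fin n → V, (klDiv π (optEstimator A x)).toReal
      ≤ ∑ i ∈ A, G i (letterCount x i) := fun x => by
    rw [toReal_klDiv_optEstimator hA']
    refine Finset.sum_le_sum fun i _ => ?_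
    have hS : 0 < ∑ j ∈ A, optWeight x j :=
      Finset.sum_pos (fun j _ => optWeight_pos x j) (nonempty_of_support hA)
    have hS' : ∑ j ∈ A, optWeight x j ≤ n + A.card := by
      refine (sum_optWeight_le A x).trans ?_
      have : ∑ i ∈ A, addConst (letterCount x i) ≤ ∑ i ∈ A, (1 : ℝ) :=
        Finset.sum_le_sum fun i _ => addConst_le_one _
      simpa using this
    rcases eq_or_ne (π.real {i}) 0 with h0 | h0
    · simp [G, h0]
    have hρ : 0 < ρ.real {i} := by
      refine lt_of_le_of_ne measureReal_nonneg fun h => h0 ?_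
      have : ρ {i} = 0 := by
        rw [measureReal_def, eq_comm, ENNReal.toReal_eq_zero_iff] at h
        exact h.resolve_right (measure_ne_top _ _)
      rw [measureReal_def, hπ this, ENNReal.toReal_zero]
    have hW := optWeight_pos x i
    have h1 := Real.log_le_sub_one_of_pos
      (div_pos (mul_pos hρ (div_pos hS hW)) hc0)
    rw [Real.log_div (mul_pos hρ (div_pos hS hW)).ne' hc0.ne', Real.log_mul hρ.ne'
      (div_pos hS hW).ne', Real.log_div hS.ne' hW.ne'] at h1
    have h2 : ρ.real {i} * ((∑ j ∈ A, optWeight x j) / optWeight x i) / c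
        ≤ (n + 1) * ρ.real {i} * (1 / ((letterCount x i : ℝ) + 1)) := by
      have h3 := inv_countWeight_le (letterCount x i)
      rw [← optWeight_eq] at h3
      calc ρ.real {i} * ((∑ j ∈ A, optWeight x j) / optWeight x i) / c
          = ρ.real {i} * ((∑ j ∈ A, optWeight x j) * (1 / optWeight x i)) / c := by
            rw [mul_one_div]
        _ ≤ ρ.real {i} * ((n + A.card) * (2 * (1 / ((letterCount x i : ℝ) + 1)))) / c := by
            gcongr
        _ = _ := by
            rw [hc]
            field_simp
    have h4 : Real.log (π.real {i}) + Real.log (∑ j ∈ A, optWeight x j)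
        - Real.log (optWeight x i) ≤ Real.log (π.real {i}) - Real.log (ρ.real {i})
          + (Real.log c - 1) + (n + 1) * ρ.real {i} * (1 / ((letterCount x i : ℝ) + 1)) := by
      linarith
    refine (mul_le_mul_of_nonneg_left h4 measureReal_nonneg).trans_eq ?_
    simp only [G]
    ring
  refine (integral_mono (integrable_sample hAE (fun x => (klDiv π (optEstimator A x)).toReal))
    (integrable_sample hAE (fun x => ∑ i ∈ A, G i (letterCount x i)))
    (fun ω => hpt (fun j => X j ω))).trans ?_
  rw [integral_finsetSum _ (fun i _ => integrable_sample hAE (fun x => G i (letterCount x i)))]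
  have hGi : ∀ i ∈ A, ∫ ω, G i (letterCount (fun j => X j ω) i) ∂P
      ≤ π.real {i} * (Real.log (π.real {i}) - Real.log (ρ.real {i})) + π.real {i} * Real.log c := by
    intro i _
    rw [integral_letterCount hI hX i (G i), binomialMean_add, binomialMean_const,
      binomialMean_const_mul]
    have h1 := mul_binomialMean_inv_succ_le (n := n) (p := ρ.real {i}) measureReal_le_one
    have h2 := mul_le_mul_of_nonneg_left h1 (measureReal_nonneg : 0 ≤ π.real {i})
    linarith
  refine (Finset.sum_le_sum hGi).trans ?_
  rw [Finset.sum_add_distrib, ← hKL, ← Finset.sum_mul, hsum]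
  linarith

end FiniteAlphabet

/-! ### The error sequence and the choice of the weight. -/

/-- The excess over `(1 - p) / 2` of the loss of a letter of probability `p`, maximised over `p`. -/
noncomputable def lossExcess (n : ℕ) : ℝ :=
  sSup ((fun p => binomialLoss n p - (1 - p) / 2) '' Set.Icc 0 1)

lemma continuous_binomialMean (n : ℕ) (f : ℕ → ℝ) : Continuous (fun p => binomialMean n p f) := by
  unfold binomialMean
  fun_prop

lemma continuous_binomialLoss (n : ℕ) : Continuous (binomialLoss n) := by
  have h1 : Continuous fun p : ℝ => n * p * Real.log (n * p) :=
    Real.continuous_mul_log.comp (continuous_const.mul continuous_id)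
  exact (h1.sub ((continuous_const.mul continuous_id).mul (continuous_binomialMean n _))).add
    (continuous_binomialMean n _)

/-- Boundedness ensures that the real `sSup` is a genuine supremum rather than the default value 0.
-/
lemma bddAbove_lossExcess (n : ℕ) :
    BddAbove ((fun p => binomialLoss n p - (1 - p) / 2) '' Set.Icc 0 1) :=
  (isCompact_Icc.image ((continuous_binomialLoss n).sub (by fun_prop))).bddAbove

lemma binomialLoss_le_lossExcess (n : ℕ) {p : ℝ} (h0 : 0 ≤ p) (h1 : p ≤ 1) :
    binomialLoss n p ≤ (1 - p) / 2 + lossExcess n := by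
  have := le_csSup (bddAbove_lossExcess n) ⟨p, ⟨h0, h1⟩, rfl⟩
  rw [lossExcess]
  linarith

/-- At `p = 0` the loss is the mean of `addConst`, which is at least 1/2. -/
lemma lossExcess_nonneg (n : ℕ) : 0 ≤ lossExcess n := by
  have h := binomialLoss_le_lossExcess n le_rfl zero_le_one
  have h2 := binomialMean_mono (n := n) le_rfl zero_le_one half_le_addConst
  rw [binomialMean_const] at h2
  simp only [binomialLoss, mul_zero, zero_mul, sub_zero, zero_add] at h
  linarith

lemma tendsto_lossExcess : Tendsto lossExcess atTop (𝓝 0) := by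
  refine tendsto_order.2 ⟨fun a ha => .of_forall fun n => ha.trans_le (lossExcess_nonneg n),
    fun a ha => ?_⟩
  filter_upwards [eventually_binomialLoss_le (half_pos ha)] with n hn
  have : lossExcess n ≤ a / 2 := by
    refine csSup_le (Set.image_nonempty.2 (Set.nonempty_Icc.2 zero_le_one)) ?_
    rintro _ ⟨p, ⟨h0, h1⟩, rfl⟩
    linarith [hn p h0 h1]
  linarith

lemma plugin_one {V : Type*} [DecidableEq V] [MeasurableSpace V] (A A₀ : Finset V) {n n₀ : ℕ}
    (x : Fin n → V) (y : Fin n₀ → V) : plugin 1 A A₀ x y = optEstimator A x := by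
  simp [plugin, interpolate]

lemma plugin_zero {V : Type*} [DecidableEq V] [MeasurableSpace V] (A A₀ : Finset V) {n n₀ : ℕ}
    (x : Fin n → V) (y : Fin n₀ → V) : plugin 0 A A₀ x y = optEstimator A₀ y := by
  simp [plugin, interpolate]

end AddConstEstimation

theorem mainTheorem6 :
    ∃ ε : ℕ → ℝ, Tendsto ε atTop (𝓝 0) ∧
      ∀ (n n₀ d d₀ : ℕ) (Δ : ℝ≥0), 1 ≤ n → 1 ≤ n₀ →
        ∃ α : ℝ, 0 ≤ α ∧ α ≤ 1 ∧
          ∀ (V : Type*) [Fintype V] [DecidableEq V] [MeasurableSpace V]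
            [MeasurableSingletonClass V]
            (A A₀ : Finset V) (π π₀ : Measure V)
            [IsProbabilityMeasure π] [IsProbabilityMeasure π₀],
            A.card = d → A₀.card = d₀ → (∀ i, i ∉ A → π {i} = 0) → (∀ i, i ∉ A₀ → π₀ {i} = 0) →
            klDiv π π₀ ≤ (Δ : ℝ≥0∞) →
            ∀ (Ω : Type*) [MeasurableSpace Ω] (P : Measure Ω) [IsProbabilityMeasure P]
              (X : Fin n → Ω → V) (Y : Fin n₀ → Ω → V),
              iIndepFun X P → (∀ j, HasLaw (X j) π P) →
              iIndepFun Y P → (∀ j, HasLaw (Y j) π₀ P) →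
              AddConstEstimation.klRisk P π (fun ω =>
                AddConstEstimation.plugin α A A₀ (fun j => X j ω) (fun j => Y j ω)) ≠ ∞ ∧
              (AddConstEstimation.klRisk P π (fun ω =>
                AddConstEstimation.plugin α A A₀ (fun j => X j ω) (fun j => Y j ω))).toReal ≤ min
                (((d : ℝ) - 1) / (2 * (n : ℝ)) + ε n * ((d : ℝ) / (n : ℝ)))
                ((Δ : ℝ) + Real.log (1 + (d₀ : ℝ) / (n₀ : ℝ)) + Real.log 2) := by
  classical
  refine ⟨AddConstEstimation.lossExcess, AddConstEstimation.tendsto_lossExcess, ?_⟩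
  intro n n₀ d d₀ Δ hn hn₀
  have hn0 : (0 : ℝ) < n := by exact_mod_cast hn
  -- The smaller of the two bounds decides which estimator is used alone, and this comparison
  -- involves only `n`, `n₀`, `d`, `d₀` and `Δ`.
  refine ⟨if ((d : ℝ) - 1) / (2 * (n : ℝ)) + AddConstEstimation.lossExcess n * ((d : ℝ) / (n : ℝ))
    ≤ (Δ : ℝ) + Real.log (1 + (d₀ : ℝ) / (n₀ : ℝ)) + Real.log 2 then 1 else 0,
    by split_ifs <;> norm_num, by split_ifs <;> norm_num, ?_⟩
  intro V _ _ _ _ A A₀ π π₀ _ _ hd hd₀ hA hA₀ hΔ Ω _ P _ X Y hIX hX hIY hY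
  -- Finite divergence forces `π` to be supported in `A₀`, where the second estimator is positive.
  -- Hence the risk is finite for `α = 0` too.
  have hac : π ≪ π₀ := (klDiv_ne_top_iff.1 (ne_top_of_le_ne_top ENNReal.coe_ne_top hΔ)).1
  split_ifs with hle
  · simp only [AddConstEstimation.plugin_one, AddConstEstimation.klRisk]
    have hfin : ∀ x : Fin n → V, klDiv π (AddConstEstimation.optEstimator A x) ≠ ∞ := fun x =>
      AddConstEstimation.klDiv_ne_top_of_ac
        (AddConstEstimation.absolutelyContinuous_optEstimator hA x)
    have hae : ∀ j, AEMeasurable (X j) P := fun j => (hX j).aemeasurable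
    refine ⟨AddConstEstimation.lintegral_sample_ne_top hae hfin, ?_⟩
    rw [AddConstEstimation.toReal_lintegral_sample hae hfin, min_eq_left hle]
    have h1 := AddConstEstimation.integral_klDiv_optEstimator_le hn hA hIX hX
    have h2 : ∑ i ∈ A, AddConstEstimation.binomialLoss n (π.real {i})
        ≤ ∑ i ∈ A, ((1 - π.real {i}) / 2 + AddConstEstimation.lossExcess n) :=
      Finset.sum_le_sum fun i _ =>
        AddConstEstimation.binomialLoss_le_lossExcess n measureReal_nonneg measureReal_le_one
    rw [Finset.sum_add_distrib, ← Finset.sum_div, Finset.sum_sub_distrib,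
      AddConstEstimation.sum_measureReal_singleton_eq_one hA, Finset.sum_const, Finset.sum_const,
      hd, nsmul_eq_mul, nsmul_eq_mul, mul_one] at h2
    have e : ((d : ℝ) - 1) / (2 * n) + AddConstEstimation.lossExcess n * (d / n)
        = (((d : ℝ) - 1) / 2 + d * AddConstEstimation.lossExcess n) / n := by
      field_simp
    rw [e, le_div_iff₀ hn0]
    linarith
  · simp only [AddConstEstimation.plugin_zero, AddConstEstimation.klRisk]
    have hA' : ∀ i, i ∉ A₀ → π {i} = 0 := fun i hi => hac (hA₀ i hi)
    have hfin : ∀ x : Fin n₀ → V, klDiv π (AddConstEstimation.optEstimator A₀ x) ≠ ∞ := fun x =>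
      AddConstEstimation.klDiv_ne_top_of_ac
        (AddConstEstimation.absolutelyContinuous_optEstimator hA' x)
    have hae : ∀ j, AEMeasurable (Y j) P := fun j => (hY j).aemeasurable
    refine ⟨AddConstEstimation.lintegral_sample_ne_top hae hfin, ?_⟩
    rw [AddConstEstimation.toReal_lintegral_sample hae hfin, min_eq_right (not_le.1 hle).le]
    have h1 := AddConstEstimation.integral_klDiv_optEstimator_le_klDiv_add hn₀ hA₀ hac hIY hY
    have h2 : (klDiv π π₀).toReal ≤ Δ := by
      have := ENNReal.toReal_mono ENNReal.coe_ne_top hΔ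
      simpa using this
    rw [hd₀] at h1
    linarith
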